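/- Let $d\ge 1$ and $k\ge 1$ be integers and $\Omega=[-1,1]^d$. Let $F_k^d$ be the space of functions $f:\Omega\to\mathbb{R}$ whose partial derivatives $D^{\alpha}f$ exist and are continuous on $\Omega$ (one-sided on $\partial\Omega$) for all $\alpha\in\mathbb{N}_0^d$ with $\alpha_i\le k$ for every $i$. Write $\|f\|_{\infty,0}=\sup_{x\in\Omega}|f(x)|$ and $\|f\|_{\infty,k}=\max\{\|D^\alpha f\|_{\infty,0}:\alpha_i\le k\text{ for all }i\}$. For a vector of scales $s\in(0,\infty)^d$ and a center $y\in\mathbb{R}^d$ let $$B_{s,y}(x)=\prod_{i=1}^d\frac{1}{\sqrt{\pi s_i^{-2}}}\exp\big(-s_i^2(x_i-y_i)^2\big),$$ and for $r\in(0,\infty)^d$ let $$\Phi(r)=\prod_{i=1}^d\int_{|t|\le r_i}\frac{1}{\sqrt{2\pi}}e^{-t^2/2}\,dt .$$ There is a constant $c_{d,k}>0$, depending only on $d$ and $k$, such that the following holds for every $\epsilon=(\epsilon_1,\dots,\epsilon_d)$ with $0<\epsilon_i<1$ and every $u\in F_k^d$ that vanishes on $\partial\Omega$. (i) There is a function $\tilde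 u:\mathbb{R}^d\to\mathbb{R}$ that equals $u$ on $\Omega$ and $0$ outside $\Omega$, is Lipschitz continuous on $\mathbb{R}^d$, and is continuously differentiable on $\mathbb{R}^d\setminus\partial\Omega$. (ii) For every integer $N\ge 2$ there are coefficients $a_1,\dots,a_N\in\mathbb{R}$ and centers $y_1,\dots,y_N\in\Omega$ such that $u_N=\sum_{j=1}^N a_jB_{\epsilon^{-1},y_j}$, where $\epsilon^{-1}=(\epsilon_1^{-1},\dots,\epsilon_d^{-1})$, satisfies $$\|u-u_N\|_{L^2(\Omega)}\le \sum_{i=1}^d\epsilon_i^{1/2}\|\partial_{x_i}u\|_{\infty,0}+2\|u\|_{\infty,0}\big(1-\Phi(\epsilon_1^{-1/2},\dots,\epsilon_d^{-1/2})\big)+\Big(\prod_{i=1}^d\epsilon_i^{-k}\Big)2^{d+2k}\,c_{d,k}\,N^{-k/2}(\log N)^{(k+2)(d-1)+1}\,\|u\|_{\infty,k}\,\|B_{\mathbf 1,\mathbf 0}\|_{\infty,k},$$ where $\mathbf 1=(1,\dots,1)$ and $\mathbf 0=(0,\dots,0)$. -/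

import Mathlib

noncomputable section

namespace GaussRBF

/-- The closed cube `[-1, 1]^d`. -/
def cube (d : ℕ) : Set (Fin d → ℝ) := Set.Icc (fun _ => -1) (fun _ => 1)

/-- The partial derivative in direction `i` of a function on the cube. At faces orthogonal to
direction `i` it is one-sided; only the values of `f` on the cube enter at points of the cube. -/
def partialD {d : ℕ} (i : Fin d) (f : (Fin d → ℝ) → ℝ) (x : Fin d → ℝ) : ℝ :=
  derivWithin (fun t => f (Function.update x i t)) (Set.Icc (-1) 1) (x i)

/-- The mixed derivative `D^α f = ∂_1^{α_1} ⋯ ∂_d^{α_d} f` on the cube. -/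
def mixedD {d : ℕ} (α : Fin d → ℕ) (f : (Fin d → ℝ) → ℝ) : (Fin d → ℝ) → ℝ :=
  ((List.finRange d).flatMap fun i => List.replicate (α i) i).foldr partialD f

/-- The space `F_k^d`: every `D^α f` with `α_i ≤ k` for all `i` exists and is continuous on the
cube. Existence is expressed by requiring that, whenever `α_i < k`, the function `D^α f` is
differentiable in direction `i` with derivative `D^{α + e_i} f` at every point of the cube, so that
the order of differentiation is immaterial. -/
def MemF {d : ℕ} (k : ℕ) (f : (Fin d → ℝ) → ℝ) : Prop :=
  ∀ α : Fin d → ℕ, (∀ i, α i ≤ k) →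
    ContinuousOn (mixedD α f) (cube d) ∧
    ∀ i, α i < k → ∀ x ∈ cube d,
      HasDerivWithinAt (fun t => mixedD α f (Function.update x i t))
        (mixedD (α + Pi.single i 1) f x) (Set.Icc (-1) 1) (x i)

/-- The supremum norm `‖f‖_{∞,0}` over the cube. -/
def supNorm {d : ℕ} (f : (Fin d → ℝ) → ℝ) : ℝ := ⨆ x : cube d, |f x|

/-- The norm `‖f‖_{∞,k} = max {‖D^α f‖_∞ : α_i ≤ k for all i}` over the cube. -/
def mixedNorm {d : ℕ} (k : ℕ) (f : (Fin d → ℝ) → ℝ) : ℝ :=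
  ⨆ α : Fin d → Fin (k + 1), supNorm (mixedD (fun i => (α i : ℕ)) f)

/-- The anisotropic Gaussian radial basis function `B_{s,y}` with scales `s` and center `y`. -/
def gaussRBF {d : ℕ} (s y x : Fin d → ℝ) : ℝ :=
  ∏ i, (1 / Real.sqrt (Real.pi * (s i) ^ (-2 : ℤ)) * Real.exp (-(s i) ^ 2 * (x i - y i) ^ 2))

/-- The standard Gaussian probability of the box `{t : |t_i| ≤ r_i}`. -/
def boxPhi {d : ℕ} (r : Fin d → ℝ) : ℝ :=
  ∏ i, ∫ t in {t : ℝ | |t| ≤ r i}, 1 / Real.sqrt (2 * Real.pi) * Real.exp (-t ^ 2 / 2)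

end GaussRBF

end

/-!
The convolution of `u` with a Gaussian is discretized by approximating the *kernel*, as a function
of its first variable, by finite Gaussian sums with coefficients that depend on the second
variable. No smoothness of `u` enters this step: the Gaussian is entire, so with `n` centres per
direction in each cell of width about `ε i` the error decays faster than every power of `n`. This
beats the rate `N ^ (-k / 2)` as soon as `N` exceeds a constant multiple of `(∏ ε i ^ (-1)) ^ 2`;
for smaller `N` the last term of the bound dominates the `L²` norm of `u`, and `u_N = 0` will do.

Let `s i = 1 / ε i`, `E = ∏ s i`, and `σ i = max (s i) Δ` with `Δ = 4 * 2 ^ d`.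

* *Smoothing.* The zero extension of `u` is Lipschitz in each coordinate direction, so its
  convolution with the product of the centred normal densities of scale `σ i` is uniformly within
  `∑ 2 / σ i * ‖∂_i u‖_∞` of `u` (`abs_sub_integral_normalDensity_le`). The `L²` norm over the cube
  costs a factor `2 ^ (d / 2)`. If `ε i` is not small, the scale `s i` is too coarse to absorb it,
  which is why the scales are raised to at least `Δ` (`sqrt_two_pow_mul_le`). The term with `Φ` is
  only used to be nonnegative.
* *The kernel in one dimension* (`exists_hasGaussExpansion`). For `σ = s` the interval is cut into
  cells of half-width at most `1 / (2 s)`, and around each midpoint `c` the factor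
  `exp (2 s² (x - c) (t - c))` is replaced by its Taylor polynomial; for `σ = Δ > s` one Taylor
  expansion around `0` suffices, with constants depending on `Δ` only. In both cases the result is a
  combination of functions `(x - c) ^ m * exp (-s² (x - c)²)`, which are limits of finite differences
  of Gaussians of scale `s` (`exists_gauss_approx_monomial`). The coefficients of the Gaussian sum
  are unrestricted, so these limits cost nothing.
* *Tensorization and counting* (`exists_gaussSum_approx_integral`, `exists_gaussSum_approx`). Products
  of the one-dimensional expansions, integrated against `u`, have at most `3 ^ d * n ^ d * E` terms
  and an error of order `E * n ^ (-d (k + 1))`. Choosing `n ^ d` comparable to `N / (3 ^ d * E)` gives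
  `E * (E / N) ^ (k + 1)` up to constants, which is at most `E ^ k * N ^ (-k / 2)` when `E ^ 2 ≤ N`.

For the first assertion, continuous partial derivatives make `u` continuously differentiable inside
the cube (`contDiffOn_one_of_continuousOn_partials`), and the Lipschitz bound is obtained by changing
one coordinate at a time (`abs_sub_le_sum_of_update`).
-/

namespace GaussRBF

open Finset MeasureTheory

/-! ### Taylor expansions of the exponential -/

theorem abs_exp_sub_taylor_le (z : ℝ) (n : ℕ) :
    |Real.exp z - ∑ m ∈ range n, z ^ m / (m.factorial : ℝ)| ≤
      |z| ^ n / (n.factorial : ℝ) * Real.exp |z| := by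
  have hs : ∀ w : ℝ, HasSum (fun m : ℕ => w ^ m / (m.factorial : ℝ)) (Real.exp w) := fun w => by
    rw [Real.exp_eq_exp_ℝ]; exact NormedSpace.expSeries_div_hasSum_exp w
  have h1 := (hasSum_nat_add_iff' n).2 (hs z)
  have h2 := (hs |z|).mul_left (|z| ^ n / (n.factorial : ℝ))
  rw [← Real.norm_eq_abs]
  refine h1.norm_le_of_bounded h2 fun m => ?_
  rw [norm_div, norm_pow, Real.norm_eq_abs, Real.norm_natCast, div_mul_div_comm, ← pow_add,
    add_comm n m]
  have h3 : (n.factorial : ℝ) * m.factorial ≤ (m + n).factorial := by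
    rw [add_comm m n]
    exact_mod_cast Nat.le_of_dvd (Nat.factorial_pos _)
      (Nat.factorial_mul_factorial_dvd_factorial_add n m)
  gcongr

theorem abs_taylor_exp_le (z : ℝ) (n : ℕ) :
    |∑ m ∈ range n, z ^ m / (m.factorial : ℝ)| ≤ Real.exp |z| := by
  refine (abs_sum_le_sum_abs _ _).trans ?_
  refine le_trans (le_of_eq ?_) (Real.sum_le_exp_of_nonneg (abs_nonneg z) n)
  simp [abs_div, abs_pow]

theorem abs_exp_mul_exp_sub_taylor_le (a b R : ℝ) (ha : |a| ≤ R) (hb : |b| ≤ R) (n : ℕ) :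
    |Real.exp a * Real.exp b - (∑ i ∈ range n, a ^ i / (i.factorial : ℝ)) *
      ∑ j ∈ range n, b ^ j / (j.factorial : ℝ)| ≤
      2 * (R ^ n / (n.factorial : ℝ) * Real.exp R ^ 2) := by
  have hR : 0 ≤ R := (abs_nonneg _).trans ha
  have h : ∀ c : ℝ, |c| ≤ R → |Real.exp c - ∑ i ∈ range n, c ^ i / (i.factorial : ℝ)| ≤
      R ^ n / (n.factorial : ℝ) * Real.exp R := fun c hc =>
    (abs_exp_sub_taylor_le c n).trans (by gcongr)
  have e : ∀ p q r t : ℝ, p * q - r * t = (p - r) * q + r * (q - t) := fun p q r t => by ring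
  rw [e]
  refine (abs_add_le _ _).trans ?_
  rw [abs_mul, abs_mul]
  have hb' : |Real.exp b| ≤ Real.exp R := by
    rw [abs_of_pos (Real.exp_pos b)]; exact Real.exp_le_exp.2 ((le_abs_self b).trans hb)
  have ha' := (abs_taylor_exp_le a n).trans (Real.exp_le_exp.2 ha)
  calc _ ≤ (R ^ n / (n.factorial : ℝ) * Real.exp R) * Real.exp R +
        Real.exp R * (R ^ n / (n.factorial : ℝ) * Real.exp R) := by
        gcongr
        · exact h a ha
        · exact h b hb
    _ = _ := by ring

theorem pow_mul_pow_div_factorial_le {R : ℝ} (hR : 0 ≤ R) (p n : ℕ) :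
    (n : ℝ) ^ p * (R ^ n / (n.factorial : ℝ)) ≤
      (p.factorial : ℝ) * Real.exp (Real.exp 1 * R) := by
  have h1 : (n : ℝ) ^ p ≤ p.factorial * Real.exp 1 ^ n := by
    have := Real.pow_div_factorial_le_exp (x := (n : ℝ)) (Nat.cast_nonneg n) p
    rw [div_le_iff₀ (by positivity)] at this
    rw [← Real.exp_nat_mul, mul_one, mul_comm]; exact this
  have h2 := Real.pow_div_factorial_le_exp (x := Real.exp 1 * R) (by positivity) n
  calc _ ≤ p.factorial * Real.exp 1 ^ n * (R ^ n / (n.factorial : ℝ)) := by gcongr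
    _ = p.factorial * ((Real.exp 1 * R) ^ n / (n.factorial : ℝ)) := by rw [mul_pow]; ring
    _ ≤ _ := by gcongr

theorem abs_pow_le_sqrt_factorial (x : ℝ) (n : ℕ) :
    |x| ^ n ≤ Real.sqrt n.factorial * Real.exp (x ^ 2 / 2) := by
  have h := Real.pow_div_factorial_le_exp (x := x ^ 2) (by positivity) n
  rw [div_le_iff₀ (by positivity)] at h
  refine abs_le_of_sq_le_sq' ?_ (by positivity) |>.2
  rw [mul_pow, Real.sq_sqrt (by positivity), ← Real.exp_nat_mul, ← pow_mul, mul_comm n 2, pow_mul,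
    sq_abs, mul_comm]
  convert h using 2
  congr 1
  push_cast; ring

/-- Uniformly in `x`: the growth of the Taylor error of `exp (2 * x * y)` is absorbed by the Gaussian
weight. -/
theorem exp_neg_sq_mul_taylor_error_le (x y : ℝ) (hy : |y| ≤ 1 / 2) (n : ℕ) :
    Real.exp (-x ^ 2) * |Real.exp (2 * x * y) -
      ∑ m ∈ range n, (2 * x * y) ^ m / (m.factorial : ℝ)| ≤
      Real.exp (1 / 2) / Real.sqrt n.factorial := by
  have hz : |2 * x * y| ≤ |x| := by
    rw [abs_mul, abs_mul, abs_two]; nlinarith [abs_nonneg x]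
  have h1 := abs_exp_sub_taylor_le (2 * x * y) n
  have h2 := abs_pow_le_sqrt_factorial x n
  have hf : (0 : ℝ) < n.factorial := by positivity
  calc _ ≤ Real.exp (-x ^ 2) * (|x| ^ n / n.factorial * Real.exp |x|) := by
        gcongr
        exact h1.trans (by gcongr)
    _ ≤ Real.exp (-x ^ 2) * ((Real.sqrt n.factorial * Real.exp (x ^ 2 / 2)) / n.factorial *
        Real.exp |x|) := by gcongr
    _ = Real.exp (-x ^ 2 + x ^ 2 / 2 + |x|) * (Real.sqrt n.factorial / n.factorial) := by
        rw [Real.exp_add, Real.exp_add]; ring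
    _ ≤ Real.exp (1 / 2) * (Real.sqrt n.factorial / n.factorial) := by
        gcongr
        nlinarith [sq_abs x, sq_nonneg (|x| - 1)]
    _ = _ := by rw [Real.sqrt_div_self, ← div_eq_mul_inv]

/-! ### Monomials times Gaussians as limits of Gaussian sums -/

/-- Powers of the difference quotient of `h ↦ exp (h * X)` at `0` tend to monomials in `X`, uniformly
on bounded sets. -/
theorem exists_abs_pow_sub_diffQuot_le (K : ℝ) (hK : 0 < K) (n : ℕ) {τ : ℝ} (hτ : 0 < τ) :
    ∃ h₀ : ℝ, 0 < h₀ ∧ ∀ h, 0 < h → h ≤ h₀ → ∀ m < n, ∀ X : ℝ, |X| ≤ K →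
      |X ^ m - ((Real.exp (h * X) - 1) / h) ^ m| ≤ τ := by
  refine ⟨min (1 / K) (min (1 / K ^ 2) (τ / (K ^ 2 * (n + 1) * (K + 1) ^ n))), by positivity, ?_⟩
  intro h hh hle m hm X hX
  have h1 : h ≤ 1 / K := hle.trans (min_le_left _ _)
  have h2 : h ≤ 1 / K ^ 2 := hle.trans ((min_le_right _ _).trans (min_le_left _ _))
  have h3 : h ≤ τ / (K ^ 2 * (n + 1) * (K + 1) ^ n) :=
    hle.trans ((min_le_right _ _).trans (min_le_right _ _))
  -- the three upper bounds on `h` serve `|h * X| ≤ 1`, `h * K ^ 2 ≤ 1` and the final estimate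
  have hd : |(Real.exp (h * X) - 1) / h - X| ≤ h * K ^ 2 := by
    have hs : |h * X| ≤ 1 := by
      rw [abs_mul, abs_of_pos hh]
      rw [le_div_iff₀ hK] at h1
      exact (mul_le_mul_of_nonneg_left hX hh.le).trans h1
    have := Real.abs_exp_sub_one_sub_id_le hs
    have e : (Real.exp (h * X) - 1) / h - X = (Real.exp (h * X) - 1 - h * X) / h := by
      field_simp
    rw [e, abs_div, abs_of_pos hh, div_le_iff₀ hh]
    refine this.trans ?_
    have : X ^ 2 ≤ K ^ 2 := by rw [← sq_abs X]; gcongr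
    nlinarith [sq_nonneg h]
  have hb : |(Real.exp (h * X) - 1) / h| ≤ K + 1 := by
    have : h * K ^ 2 ≤ 1 := by rwa [le_div_iff₀ (by positivity)] at h2
    have e : (Real.exp (h * X) - 1) / h = ((Real.exp (h * X) - 1) / h - X) + X := by ring
    rw [e]
    exact (abs_add_le _ _).trans (by linarith)
  rw [abs_sub_comm] at hd
  refine (abs_pow_sub_pow_le _ _ _).trans ?_
  have hmax : max |X| |(Real.exp (h * X) - 1) / h| ≤ K + 1 := max_le (by linarith) hb
  have hpow : max |X| |(Real.exp (h * X) - 1) / h| ^ (m - 1) ≤ (K + 1) ^ n :=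
    (pow_le_pow_left₀ (le_max_of_le_left (abs_nonneg _)) hmax _).trans
      (pow_le_pow_right₀ (by linarith) (by omega))
  have hmn : (m : ℝ) ≤ n + 1 := by
    have : (m : ℝ) ≤ n := by exact_mod_cast hm.le
    linarith
  calc _ ≤ (h * K ^ 2) * (n + 1) * (K + 1) ^ n := by gcongr
    _ = h * (K ^ 2 * (n + 1) * (K + 1) ^ n) := by ring
    _ ≤ τ := by rwa [le_div_iff₀ (by positivity)] at h3

/-- The `m`-th forward difference in the centre of a Gaussian, with weights `exp (s² (j h)²)`, equals
`exp (-s² (x - c)²)` times the `m`-th power of a difference quotient of `exp`. Hence `n` Gaussians with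
the same centres `c + j h` approximate all `(x - c) ^ m * exp (-s² (x - c)²)` with `m < n`. -/
theorem exists_gauss_approx_monomial {s : ℝ} (hs : 0 < s) {c : ℝ} (hc : -1 < c) (hc' : c < 1)
    (n : ℕ) {τ : ℝ} (hτ : 0 < τ) :
    ∃ (y : Fin n → ℝ) (b : ℕ → Fin n → ℝ), (∀ j, y j ∈ Set.Icc (-1 : ℝ) 1) ∧
      ∀ m < n, ∀ x ∈ Set.Icc (-1 : ℝ) 1,
        |(x - c) ^ m * Real.exp (-s ^ 2 * (x - c) ^ 2) -
          ∑ j, b m j * Real.exp (-s ^ 2 * (x - y j) ^ 2)| ≤ τ := by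
  set a := 2 * s ^ 2 with ha
  have hapos : 0 < a := by positivity
  obtain ⟨h₀, hh₀, H⟩ := exists_abs_pow_sub_diffQuot_le (a * 2) (by positivity) n
    (τ := τ * (min 1 a) ^ n) (by positivity)
  set h := min h₀ ((1 - c) / (n + 1)) with hh
  have hpos : 0 < h := lt_min hh₀ (div_pos (by linarith) (by positivity))
  have hle : h * (n + 1) ≤ 1 - c := by
    have : h ≤ (1 - c) / (n + 1) := min_le_right _ _
    rwa [le_div_iff₀ (by positivity)] at this
  refine ⟨fun j => c + j * h, fun m j => (a * h)⁻¹ ^ m * (-1) ^ (m - j : ℕ) * (m.choose j) *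
    Real.exp (s ^ 2 * (j * h) ^ 2), fun j => ⟨?_, ?_⟩, ?_⟩
  · have : 0 ≤ (j : ℝ) * h := by positivity
    linarith
  · have : (j : ℝ) * h ≤ (n + 1) * h := by
      gcongr
      have : ((j : ℕ) : ℝ) ≤ n := by exact_mod_cast j.2.le
      linarith
    linarith
  · intro m hm x hx
    have hX : |a * (x - c)| ≤ a * 2 := by
      rw [abs_mul, abs_of_pos hapos]
      gcongr
      rw [abs_le]; constructor <;> linarith [hx.1, hx.2]
    have key := H h hpos (min_le_left _ _) m hm _ hX
    -- the binomial theorem; terms with `j > m` vanish with the binomial coefficient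
    have e : ∑ j : Fin n, (a * h)⁻¹ ^ m * (-1) ^ (m - j : ℕ) * (m.choose j) *
        Real.exp (s ^ 2 * (j * h) ^ 2) * Real.exp (-s ^ 2 * (x - (c + j * h)) ^ 2) =
        Real.exp (-s ^ 2 * (x - c) ^ 2) * a⁻¹ ^ m *
          ((Real.exp (h * (a * (x - c))) - 1) / h) ^ m := by
      rw [Fin.sum_univ_eq_sum_range (fun j : ℕ => (a * h)⁻¹ ^ m * (-1) ^ (m - j : ℕ) *
        (m.choose j) * Real.exp (s ^ 2 * (j * h) ^ 2) * Real.exp (-s ^ 2 * (x - (c + j * h)) ^ 2)) n]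
      rw [← sum_subset (range_subset_range.2 (Nat.succ_le_iff.2 hm))]
      · rw [div_pow, sub_eq_add_neg (Real.exp _) 1, add_pow, mul_inv, mul_pow, div_eq_mul_inv,
          ← inv_pow h m, sum_mul, mul_sum]
        refine sum_congr rfl fun j _ => ?_
        have e2 : Real.exp (s ^ 2 * (j * h) ^ 2) * Real.exp (-s ^ 2 * (x - (c + j * h)) ^ 2) =
            Real.exp (-s ^ 2 * (x - c) ^ 2) * Real.exp (h * (a * (x - c))) ^ j := by
          rw [← Real.exp_nat_mul, ← Real.exp_add, ← Real.exp_add, ha]; congr 1; ring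
        rw [mul_assoc _ (Real.exp _), e2]; ring
      · intro j _ hj
        rw [mem_range, not_lt] at hj
        rw [Nat.choose_eq_zero_of_lt (by omega)]; simp
    rw [e]
    have e3 : (x - c) ^ m = a⁻¹ ^ m * (a * (x - c)) ^ m := by
      rw [← mul_pow, inv_mul_cancel_left₀ hapos.ne']
    rw [e3, mul_comm _ (Real.exp _), ← mul_assoc, ← mul_sub, abs_mul]
    have h1 : |Real.exp (-s ^ 2 * (x - c) ^ 2) * a⁻¹ ^ m| ≤ a⁻¹ ^ m := by
      rw [abs_of_pos (by positivity)]
      refine mul_le_of_le_one_left (by positivity) ?_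
      rw [Real.exp_le_one_iff]; nlinarith [sq_nonneg (s * (x - c))]
    calc _ ≤ a⁻¹ ^ m * (τ * min 1 a ^ n) := by gcongr
      _ ≤ a⁻¹ ^ m * (τ * a ^ m) := by
        have h4 : min 1 a ^ n ≤ min 1 a ^ m :=
          pow_le_pow_of_le_one (by positivity) (min_le_left _ _) hm.le
        have h5 : min 1 a ^ m ≤ a ^ m := pow_le_pow_left₀ (by positivity) (min_le_right _ _) _
        gcongr
        exact h4.trans h5
      _ = τ := by rw [inv_pow]; field_simp

/-- A finite expansion of a kernel in the functions `(x - c) ^ m * exp (-s² (x - c)²)`, `m < n`, is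
approximated by an expansion in `n` Gaussians of scale `s`. -/
theorem exists_gauss_approx_of_expansion {s : ℝ} (hs : 0 < s) {c : ℝ} (hc : -1 < c) (hc' : c < 1)
    (n : ℕ) {ι : Type*} [Fintype ι] (e : ι → ℕ) (he : ∀ i, e i < n) (q : ι → ℝ → ℝ)
    (hq : ∀ i, Continuous (q i)) {τ : ℝ} (hτ : 0 < τ) :
    ∃ (y : Fin n → ℝ) (l : Fin n → ℝ → ℝ), (∀ j, y j ∈ Set.Icc (-1 : ℝ) 1) ∧
      (∀ j, Continuous (l j)) ∧ ∀ x ∈ Set.Icc (-1 : ℝ) 1, ∀ t ∈ Set.Icc (-1 : ℝ) 1,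
        |∑ i, q i t * ((x - c) ^ e i * Real.exp (-s ^ 2 * (x - c) ^ 2)) -
          ∑ j, l j t * Real.exp (-s ^ 2 * (x - y j) ^ 2)| ≤ τ := by
  have hcont : Continuous fun t => ∑ i, |q i t| := by fun_prop
  obtain ⟨Q, hQ⟩ := (isCompact_Icc (a := (-1 : ℝ)) (b := 1)).exists_bound_of_continuousOn
    hcont.continuousOn
  have hQ0 : 0 ≤ Q := (norm_nonneg _).trans (hQ 0 (by simp))
  obtain ⟨y, b, hy, H⟩ := exists_gauss_approx_monomial hs hc hc' n (τ := τ / (Q + 1))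
    (by positivity)
  refine ⟨y, fun j t => ∑ i, q i t * b (e i) j, hy, fun j => by fun_prop, fun x hx t ht => ?_⟩
  have e1 : ∑ i, q i t * ((x - c) ^ e i * Real.exp (-s ^ 2 * (x - c) ^ 2)) -
      ∑ j, (∑ i, q i t * b (e i) j) * Real.exp (-s ^ 2 * (x - y j) ^ 2) =
      ∑ i, q i t * ((x - c) ^ e i * Real.exp (-s ^ 2 * (x - c) ^ 2) -
        ∑ j, b (e i) j * Real.exp (-s ^ 2 * (x - y j) ^ 2)) := by
    simp_rw [mul_sub, sum_sub_distrib, mul_sum, sum_mul]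
    rw [sum_comm (s := (univ : Finset (Fin n)))]
    simp_rw [mul_assoc]
  rw [e1]
  refine (abs_sum_le_sum_abs _ _).trans ?_
  calc _ ≤ ∑ i, |q i t| * (τ / (Q + 1)) := by
        refine sum_le_sum fun i _ => ?_
        rw [abs_mul]
        exact mul_le_mul_of_nonneg_left (H _ (he i) x hx) (abs_nonneg _)
    _ = (∑ i, |q i t|) * (τ / (Q + 1)) := by rw [sum_mul]
    _ ≤ (Q + 1) * (τ / (Q + 1)) := by
        gcongr
        have := (le_abs_self _).trans (hQ t ht)
        linarith
    _ = τ := by field_simp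

/-! ### Expansion of the one-dimensional Gaussian kernel -/

/-- The kernel `exp (-σ² (x - t)²)` on `[-1, 1]²` is, up to an error `τ`, a sum
`∑ l_j(t) exp (-s² (x - y_j)²)` of at most `M` terms, with centres in `[-1, 1]` and bounded measurable
coefficient functions. -/
def HasGaussExpansion (s σ M τ : ℝ) : Prop :=
  ∃ (J : Type) (_ : Fintype J) (y : J → ℝ) (l : J → ℝ → ℝ), (Fintype.card J : ℝ) ≤ M ∧
    (∀ j, y j ∈ Set.Icc (-1 : ℝ) 1) ∧ (∀ j, Measurable (l j)) ∧
    (∀ j, ∃ B, ∀ t ∈ Set.Icc (-1 : ℝ) 1, |l j t| ≤ B) ∧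
    ∀ x ∈ Set.Icc (-1 : ℝ) 1, ∀ t ∈ Set.Icc (-1 : ℝ) 1,
      |Real.exp (-σ ^ 2 * (x - t) ^ 2) - ∑ j, l j t * Real.exp (-s ^ 2 * (x - y j) ^ 2)| ≤ τ

/-- A narrow Gaussian kernel in terms of wide Gaussians, by Taylor expansion around `0`. The constant
grows with `σ`, so this is of use for bounded `σ` only. -/
theorem hasGaussExpansion_of_le {s σ : ℝ} (hs : 1 ≤ s) (hσ : s ≤ σ) (p : ℕ) {n : ℕ} (hn : 1 ≤ n) :
    HasGaussExpansion s σ (3 * n * s)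
      ((2 * (p.factorial * Real.exp (Real.exp 1 * (2 * σ ^ 2)) * Real.exp (2 * σ ^ 2) ^ 2) + 1) /
        n ^ p) := by
  have hn0 : (0 : ℝ) < n := by exact_mod_cast hn
  -- the monomials are `(x ^ 2) ^ i * x ^ j` with `i, j < n`, hence of degree less than `3 * n`
  obtain ⟨y, l, hy, hl, H⟩ := exists_gauss_approx_of_expansion (s := s) (by linarith) (c := 0)
    (by norm_num) (by norm_num) (3 * n) (ι := Fin n × Fin n) (fun i => 2 * i.1 + i.2)
    (fun i => by have := i.1.2; have := i.2.2; omega)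
    (fun i t => Real.exp (-σ ^ 2 * t ^ 2) * ((s ^ 2 - σ ^ 2) ^ (i.1 : ℕ) / (i.1 : ℕ).factorial *
      ((2 * σ ^ 2 * t) ^ (i.2 : ℕ) / (i.2 : ℕ).factorial)))
    (fun i => by fun_prop) (τ := 1 / n ^ p) (by positivity)
  refine ⟨Fin (3 * n), inferInstance, y, l, ?_, hy, fun j => (hl j).measurable, fun j => ?_, ?_⟩
  · simp only [Fintype.card_fin]; push_cast
    nlinarith
  · obtain ⟨B, hB⟩ := (isCompact_Icc (a := (-1 : ℝ)) (b := 1)).exists_bound_of_continuousOn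
      (hl j).continuousOn
    exact ⟨B, hB⟩
  intro x hx t ht
  have hx1 : |x| ≤ 1 := abs_le.2 hx
  have ht1 : |t| ≤ 1 := abs_le.2 ht
  have hx2 : x ^ 2 ≤ 1 := by rw [← sq_abs]; exact pow_le_one₀ (abs_nonneg _) hx1
  have hσs : s ^ 2 ≤ σ ^ 2 := by gcongr
  have key := abs_exp_mul_exp_sub_taylor_le ((s ^ 2 - σ ^ 2) * x ^ 2) (2 * σ ^ 2 * t * x)
    (2 * σ ^ 2) (by
      rw [abs_mul, abs_of_nonneg (sq_nonneg x), abs_of_nonpos (by linarith)]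
      nlinarith [sq_nonneg x, sq_nonneg s, mul_nonneg (sub_nonneg.2 hσs) (sub_nonneg.2 hx2)]) (by
      rw [abs_mul, abs_mul, abs_of_nonneg (by positivity : 0 ≤ 2 * σ ^ 2)]
      calc _ ≤ 2 * σ ^ 2 * 1 * 1 := by gcongr
        _ = _ := by ring) n
  have e1 : Real.exp (-σ ^ 2 * (x - t) ^ 2) = Real.exp (-σ ^ 2 * t ^ 2) * Real.exp (-s ^ 2 * x ^ 2) *
      (Real.exp ((s ^ 2 - σ ^ 2) * x ^ 2) * Real.exp (2 * σ ^ 2 * t * x)) := by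
    rw [← Real.exp_add, ← Real.exp_add, ← Real.exp_add]; congr 1; ring
  have e2 : ∑ i : Fin n × Fin n, Real.exp (-σ ^ 2 * t ^ 2) *
      ((s ^ 2 - σ ^ 2) ^ (i.1 : ℕ) / (i.1 : ℕ).factorial *
      ((2 * σ ^ 2 * t) ^ (i.2 : ℕ) / (i.2 : ℕ).factorial)) *
      ((x - 0) ^ (2 * (i.1 : ℕ) + i.2) * Real.exp (-s ^ 2 * (x - 0) ^ 2)) =
      Real.exp (-σ ^ 2 * t ^ 2) * Real.exp (-s ^ 2 * x ^ 2) *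
      ((∑ i ∈ range n, ((s ^ 2 - σ ^ 2) * x ^ 2) ^ i / (i.factorial : ℝ)) *
        ∑ j ∈ range n, (2 * σ ^ 2 * t * x) ^ j / (j.factorial : ℝ)) := by
    rw [← Fin.sum_univ_eq_sum_range
        (fun i : ℕ => ((s ^ 2 - σ ^ 2) * x ^ 2) ^ i / (i.factorial : ℝ)),
      ← Fin.sum_univ_eq_sum_range
        (fun j : ℕ => (2 * σ ^ 2 * t * x) ^ j / (j.factorial : ℝ)), sum_mul_sum,
      Fintype.sum_prod_type, mul_sum]
    refine sum_congr rfl fun i _ => ?_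
    rw [mul_sum]
    refine sum_congr rfl fun j _ => ?_
    rw [sub_zero, mul_pow _ (x ^ 2), mul_pow _ x, pow_add, pow_mul]; ring
  have key2 := H x hx t ht
  rw [e2] at key2
  rw [add_div]
  refine (abs_sub_le _ _ _).trans (add_le_add ?_ key2)
  · rw [e1, ← mul_sub, abs_mul]
    have h1 : |Real.exp (-σ ^ 2 * t ^ 2) * Real.exp (-s ^ 2 * x ^ 2)| ≤ 1 := by
      rw [abs_of_pos (by positivity), ← Real.exp_add, Real.exp_le_one_iff]
      nlinarith [sq_nonneg (σ * t), sq_nonneg (s * x)]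
    refine (mul_le_of_le_one_left (abs_nonneg _) h1).trans (key.trans ?_)
    rw [le_div_iff₀ (by positivity)]
    have := pow_mul_pow_div_factorial_le (R := 2 * σ ^ 2) (by positivity) p n
    calc _ = 2 * (n ^ p * ((2 * σ ^ 2) ^ n / n.factorial) * Real.exp (2 * σ ^ 2) ^ 2) := by ring
      _ ≤ _ := by gcongr

/-- On a partition of `[-1, 1]` into `m` equal cells, the index of the cell containing a point. -/
noncomputable def cellIndex (m : ℕ) (t : ℝ) : ℕ := min ⌊(t + 1) * m / 2⌋₊ (m - 1)

/-- The midpoint of a cell. -/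
noncomputable def cellMid (m k : ℕ) : ℝ := -1 + (2 * k + 1) / m

theorem abs_sub_cellMid_le {m : ℕ} (hm : 1 ≤ m) {t : ℝ} (ht : t ∈ Set.Icc (-1 : ℝ) 1) :
    |t - cellMid m (cellIndex m t)| ≤ 1 / m := by
  have hm0 : (0 : ℝ) < m := by exact_mod_cast hm
  have h0 : 0 ≤ (t + 1) * m / 2 := by have := ht.1; have : 0 ≤ t + 1 := by linarith
                                      positivity
  have h1 := Nat.floor_le h0
  have h2 := Nat.lt_floor_add_one ((t + 1) * m / 2)
  have h3 : (t + 1) * m / 2 ≤ m := by nlinarith [ht.2]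
  have key : |(t + 1) * m - (2 * (cellIndex m t : ℝ) + 1)| ≤ 1 := by
    rw [abs_le]
    unfold cellIndex
    rcases le_total ⌊(t + 1) * m / 2⌋₊ (m - 1) with h | h
    · rw [min_eq_left h]; constructor <;> linarith
    · rw [min_eq_right h]
      have h4 : ((m - 1 : ℕ) : ℝ) = m - 1 := by rw [Nat.cast_sub hm]; simp
      have h5 : ((m - 1 : ℕ) : ℝ) ≤ ⌊(t + 1) * m / 2⌋₊ := by exact_mod_cast h
      rw [h4] at h5 ⊢
      constructor <;> linarith
  have e : t - cellMid m (cellIndex m t) = ((t + 1) * m - (2 * (cellIndex m t : ℝ) + 1)) / m := by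
    unfold cellMid; field_simp; ring
  rw [e, abs_div, abs_of_pos hm0]
  gcongr

theorem measurable_cellIndex (m : ℕ) : Measurable (cellIndex m) := by
  unfold cellIndex
  exact (Nat.measurable_floor.comp (by fun_prop)).min measurable_const

/-- The case of equal scales, by Taylor expansion around the midpoints of about `2 * s` cells. The
constant does not depend on `s`. -/
theorem hasGaussExpansion_self {s : ℝ} (hs : 1 ≤ s) (p : ℕ) {n : ℕ} (hn : 1 ≤ n) :
    HasGaussExpansion s s (3 * n * s)
      ((Real.exp (1 / 2) * Real.sqrt ((2 * p).factorial * Real.exp (Real.exp 1 * 1)) + 1) /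
        n ^ p) := by
  have hn0 : (0 : ℝ) < n := by exact_mod_cast hn
  have hs0 : 0 < s := by linarith
  set m := ⌈2 * s⌉₊ with hm
  have hm2 : 2 * s ≤ m := Nat.le_ceil _
  have hm3 : (m : ℝ) ≤ 3 * s := by
    have := (Nat.ceil_lt_add_one (by linarith : 0 ≤ 2 * s)).le
    linarith
  have hm0 : (0 : ℝ) < m := by linarith
  have hm1 : 1 ≤ m := by exact_mod_cast (by linarith : (1 : ℝ) ≤ m)
  have hc : ∀ k : Fin m, -1 < cellMid m k ∧ cellMid m k < 1 := fun k => by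
    unfold cellMid
    have hk : ((k : ℕ) : ℝ) + 1 ≤ m := by exact_mod_cast k.2
    constructor
    · have : (0 : ℝ) < (2 * ((k : ℕ) : ℝ) + 1) / m := by positivity
      linarith
    · have : (2 * ((k : ℕ) : ℝ) + 1) / m < 2 := by rw [div_lt_iff₀ hm0]; linarith
      linarith
  have hloc := fun k : Fin m => exists_gauss_approx_of_expansion (s := s) hs0 (hc k).1 (hc k).2 n
    (ι := Fin n) (fun i => i) (fun i => i.2)
    (fun i t => Real.exp (-s ^ 2 * (t - cellMid m k) ^ 2) *
      ((2 * s ^ 2 * (t - cellMid m k)) ^ (i : ℕ) / (i : ℕ).factorial))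
    (fun i => by fun_prop) (τ := 1 / n ^ p) (by positivity)
  choose y l hy hl H using hloc
  refine ⟨Fin m × Fin n, inferInstance, fun j => y j.1 j.2,
    fun j t => if cellIndex m t = j.1 then l j.1 j.2 t else 0, ?_, fun j => hy _ _, fun j => ?_,
    fun j => ?_, ?_⟩
  · simp only [Fintype.card_prod, Fintype.card_fin]; push_cast
    nlinarith
  · exact Measurable.ite (measurable_cellIndex m (measurableSet_singleton _)) (hl _ _).measurable
      measurable_const
  · obtain ⟨B, hB⟩ := (isCompact_Icc (a := (-1 : ℝ)) (b := 1)).exists_bound_of_continuousOn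
      (hl j.1 j.2).continuousOn
    refine ⟨B, fun t ht => ?_⟩
    have := hB t ht
    dsimp only
    split_ifs
    · exact this
    · rw [abs_zero]; exact (norm_nonneg _).trans this
  intro x hx t ht
  have hk : cellIndex m t < m := by unfold cellIndex; omega
  set k : Fin m := ⟨cellIndex m t, hk⟩ with hkdef
  have esum : ∑ j : Fin m × Fin n, (if cellIndex m t = j.1 then l j.1 j.2 t else 0) *
      Real.exp (-s ^ 2 * (x - y j.1 j.2) ^ 2) =
      ∑ j, l k j t * Real.exp (-s ^ 2 * (x - y k j) ^ 2) := by
    rw [Fintype.sum_prod_type, sum_eq_single k]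
    · simp [hkdef]
    · intro b _ hb
      refine sum_eq_zero fun j _ => ?_
      rw [if_neg, zero_mul]
      intro h; exact hb (Fin.ext h.symm)
    · simp
  rw [esum]
  have key2 := H k x hx t ht
  have hcell := abs_sub_cellMid_le hm1 ht
  set c := cellMid m (cellIndex m t) with hcdef
  have hY : |s * (t - c)| ≤ 1 / 2 := by
    rw [abs_mul, abs_of_pos hs0]
    calc _ ≤ s * (1 / m) := by gcongr
      _ ≤ 1 / 2 := by rw [mul_one_div, div_le_div_iff₀ hm0 two_pos]; linarith
  have key := exp_neg_sq_mul_taylor_error_le (s * (x - c)) (s * (t - c)) hY n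
  have e1 : Real.exp (-s ^ 2 * (x - t) ^ 2) = Real.exp (-s ^ 2 * (t - c) ^ 2) *
      (Real.exp (-(s * (x - c)) ^ 2) * Real.exp (2 * (s * (x - c)) * (s * (t - c)))) := by
    rw [← Real.exp_add, ← Real.exp_add]; congr 1; ring
  have e2 : ∑ i : Fin n, Real.exp (-s ^ 2 * (t - c) ^ 2) *
      ((2 * s ^ 2 * (t - c)) ^ (i : ℕ) / (i : ℕ).factorial) *
      ((x - c) ^ (i : ℕ) * Real.exp (-s ^ 2 * (x - c) ^ 2)) =
      Real.exp (-s ^ 2 * (t - c) ^ 2) * (Real.exp (-(s * (x - c)) ^ 2) *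
      ∑ i ∈ range n, (2 * (s * (x - c)) * (s * (t - c))) ^ i / (i.factorial : ℝ)) := by
    rw [← Fin.sum_univ_eq_sum_range
        (fun i : ℕ => (2 * (s * (x - c)) * (s * (t - c))) ^ i / (i.factorial : ℝ)), mul_sum, mul_sum]
    refine sum_congr rfl fun i _ => ?_
    have : 2 * (s * (x - c)) * (s * (t - c)) = (2 * s ^ 2 * (t - c)) * (x - c) := by ring
    have h2 : -(s * (x - c)) ^ 2 = -s ^ 2 * (x - c) ^ 2 := by ring
    rw [h2, this, mul_pow (2 * s ^ 2 * (t - c)) (x - c)]; ring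
  rw [e2] at key2
  rw [add_div]
  refine (abs_sub_le _ _ _).trans (add_le_add ?_ key2)
  · rw [e1, ← mul_sub, ← mul_sub, abs_mul, abs_mul, abs_of_pos (Real.exp_pos _),
      abs_of_pos (Real.exp_pos _)]
    have h1 : Real.exp (-s ^ 2 * (t - c) ^ 2) ≤ 1 := by
      rw [Real.exp_le_one_iff]; nlinarith [sq_nonneg (s * (t - c))]
    refine (mul_le_of_le_one_left (by positivity) h1).trans (key.trans ?_)
    have := pow_mul_pow_div_factorial_le (R := 1) (by positivity) (2 * p) n
    have h3 : (n : ℝ) ^ p / Real.sqrt n.factorial ≤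
        Real.sqrt ((2 * p).factorial * Real.exp (Real.exp 1 * 1)) := by
      refine Real.le_sqrt_of_sq_le ?_
      rw [div_pow, Real.sq_sqrt (by positivity), ← pow_mul, mul_comm p 2]
      simpa [div_eq_mul_inv] using this
    rw [le_div_iff₀ (by positivity)]
    calc _ = Real.exp (1 / 2) * (n ^ p / Real.sqrt n.factorial) := by ring
      _ ≤ _ := by gcongr

theorem HasGaussExpansion.mono {s σ M τ τ' : ℝ} (h : HasGaussExpansion s σ M τ) (hτ : τ ≤ τ') :
    HasGaussExpansion s σ M τ' := by
  obtain ⟨J, i, y, l, h1, h2, h3, h4, h5⟩ := h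
  exact ⟨J, i, y, l, h1, h2, h3, h4, fun x hx t ht => (h5 x hx t ht).trans hτ⟩

theorem exists_hasGaussExpansion (Δ : ℝ) (p : ℕ) :
    ∃ C : ℝ, 0 < C ∧ ∀ s : ℝ, 1 ≤ s → ∀ n : ℕ, 1 ≤ n →
      HasGaussExpansion s (max s Δ) (3 * n * s) (C / n ^ p) := by
  refine ⟨max (2 * (p.factorial * Real.exp (Real.exp 1 * (2 * Δ ^ 2)) *
      Real.exp (2 * Δ ^ 2) ^ 2) + 1)
    (Real.exp (1 / 2) * Real.sqrt ((2 * p).factorial * Real.exp (Real.exp 1 * 1)) + 1),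
    lt_max_of_lt_left (by positivity), fun s hs n hn => ?_⟩
  rcases le_total s Δ with h | h
  · rw [max_eq_right h]
    refine (hasGaussExpansion_of_le hs h p hn).mono ?_
    gcongr
    exact le_max_left _ _
  · rw [max_eq_left h]
    refine (hasGaussExpansion_self hs p hn).mono ?_
    gcongr
    exact le_max_right _ _

/-! ### Tensor products -/

theorem abs_prod_sub_prod_le {ι : Type*} (A : Finset ι) (a b : ι → ℝ) {B τ : ℝ} (hB : 1 ≤ B)
    (ha : ∀ i ∈ A, |a i| ≤ B) (hb : ∀ i ∈ A, |b i| ≤ B) (hab : ∀ i ∈ A, |a i - b i| ≤ τ) :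
    |∏ i ∈ A, a i - ∏ i ∈ A, b i| ≤ A.card * B ^ A.card * τ := by
  classical
  induction A using Finset.induction_on with
  | empty => simp
  | insert i A hi ih =>
    rw [prod_insert hi, prod_insert hi, card_insert_of_notMem hi]
    have e : a i * ∏ j ∈ A, a j - b i * ∏ j ∈ A, b j =
      (a i - b i) * ∏ j ∈ A, a j + b i * (∏ j ∈ A, a j - ∏ j ∈ A, b j) := by ring
    have h1 := ih (fun j hj => ha j (mem_insert_of_mem hj)) (fun j hj => hb j (mem_insert_of_mem hj))
      (fun j hj => hab j (mem_insert_of_mem hj))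
    have h2 : |∏ j ∈ A, a j| ≤ B ^ A.card := by
      rw [abs_prod, ← prod_const]
      exact prod_le_prod (fun _ _ => abs_nonneg _) fun j hj => ha j (mem_insert_of_mem hj)
    have hτ : 0 ≤ τ := (abs_nonneg _).trans (hab i (mem_insert_self _ _))
    have hB0 : 0 ≤ B := by linarith
    rw [e]
    refine (abs_add_le _ _).trans ?_
    rw [abs_mul, abs_mul]
    calc _ ≤ τ * B ^ A.card + B * (A.card * B ^ A.card * τ) := by
          gcongr
          · exact hab i (mem_insert_self _ _)
          · exact hb i (mem_insert_self _ _)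
      _ ≤ τ * (B ^ A.card * B) + B * (A.card * B ^ A.card * τ) := by
          gcongr
          exact le_mul_of_one_le_right (by positivity) hB
      _ = _ := by push_cast; ring

theorem isCompact_cube (d : ℕ) : IsCompact (cube d) := isCompact_Icc

theorem mem_cube_iff {d : ℕ} {x : Fin d → ℝ} : x ∈ cube d ↔ ∀ i, x i ∈ Set.Icc (-1 : ℝ) 1 := by
  simp only [cube, Set.mem_Icc, Pi.le_def]
  exact ⟨fun h i => ⟨h.1 i, h.2 i⟩, fun h => ⟨fun i => (h i).1, fun i => (h i).2⟩⟩

theorem volume_cube (d : ℕ) : volume (cube d) = ENNReal.ofReal (2 ^ d) := by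
  rw [cube, Real.volume_Icc_pi]
  norm_num [ENNReal.ofReal_pow]

theorem integrableOn_cube_mul_prod {d : ℕ} {u : (Fin d → ℝ) → ℝ} (hu : ContinuousOn u (cube d))
    (l : Fin d → ℝ → ℝ) (hl : ∀ i, Measurable (l i))
    (hb : ∀ i, ∃ B, ∀ t ∈ Set.Icc (-1 : ℝ) 1, |l i t| ≤ B) :
    IntegrableOn (fun t => u t * ∏ i, l i (t i)) (cube d) := by
  choose B hB using hb
  obtain ⟨S, hS⟩ := (isCompact_cube d).exists_bound_of_continuousOn hu
  have hmeas : MeasurableSet (cube d) := (isCompact_cube d).measurableSet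
  refine IntegrableOn.of_bound (isCompact_cube d).measure_lt_top ?_ (S * ∏ i, B i) ?_
  · exact (hu.aestronglyMeasurable hmeas).mul
      (Finset.measurable_prod _ fun i _ => (hl i).comp (measurable_pi_apply i)).aestronglyMeasurable
  · refine (ae_restrict_iff' hmeas).2 (Filter.Eventually.of_forall fun t ht => ?_)
    rw [norm_mul]
    have h1 : ‖∏ i, l i (t i)‖ ≤ ∏ i, B i := by
      rw [norm_prod]
      exact prod_le_prod (fun _ _ => norm_nonneg _) fun i _ => hB i _ (mem_cube_iff.1 ht i)
    gcongr
    · exact (norm_nonneg _).trans (hS t ht)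
    · exact hS t ht

/-- Tensor products of one-dimensional expansions of Gaussian kernels, integrated against `u`. -/
theorem exists_gaussSum_approx_integral {d : ℕ} {s σ M : Fin d → ℝ} {τ S : ℝ} (hτ : 0 ≤ τ)
    (h : ∀ i, HasGaussExpansion (s i) (σ i) (M i) τ) {u : (Fin d → ℝ) → ℝ}
    (hu : ContinuousOn u (cube d)) (hS : ∀ x ∈ cube d, |u x| ≤ S) :
    ∃ (J : Type) (_ : Fintype J) (y : J → Fin d → ℝ) (a : J → ℝ),
      (Fintype.card J : ℝ) ≤ ∏ i, M i ∧ (∀ j, y j ∈ cube d) ∧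
      ∀ x ∈ cube d,
        |(∫ t in cube d, u t * ∏ i, Real.exp (-σ i ^ 2 * (x i - t i) ^ 2)) -
          ∑ j, a j * ∏ i, Real.exp (-s i ^ 2 * (x i - y j i) ^ 2)| ≤
        S * (d * (1 + τ) ^ d * τ) * 2 ^ d := by
  choose J instJ y l hcard hy hlm hlb H using h
  refine ⟨∀ i, J i, inferInstance, fun j i => y i (j i),
    fun j => ∫ t in cube d, u t * ∏ i, l i (j i) (t i), ?_,
    fun j => mem_cube_iff.2 fun i => hy i _, fun x hx => ?_⟩
  · rw [Fintype.card_pi]; push_cast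
    exact prod_le_prod (fun _ _ => by positivity) fun i _ => hcard i
  have hS0 : 0 ≤ S := (abs_nonneg _).trans (hS x hx)
  have hint1 := integrableOn_cube_mul_prod hu (fun i t => Real.exp (-σ i ^ 2 * (x i - t) ^ 2))
    (fun i => by fun_prop) (fun i => ⟨1, fun t _ => by
      rw [abs_of_pos (Real.exp_pos _), Real.exp_le_one_iff]
      nlinarith [sq_nonneg (σ i * (x i - t))]⟩)
  have hint2 := fun j : (∀ i, J i) => integrableOn_cube_mul_prod hu (fun i => l i (j i))
    (fun i => hlm i _) (fun i => hlb i _)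
  have hint3 := fun j : (∀ i, J i) =>
    (hint2 j).mul_const (∏ i, Real.exp (-s i ^ 2 * (x i - y i (j i)) ^ 2))
  have e1 : ∑ j : (∀ i, J i), (∫ t in cube d, u t * ∏ i, l i (j i) (t i)) *
      ∏ i, Real.exp (-s i ^ 2 * (x i - y i (j i)) ^ 2) =
      ∫ t in cube d, ∑ j : (∀ i, J i), (u t * ∏ i, l i (j i) (t i)) *
        ∏ i, Real.exp (-s i ^ 2 * (x i - y i (j i)) ^ 2) := by
    rw [integral_finsetSum _ fun j _ => hint3 j]
    simp_rw [integral_mul_const]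
  rw [e1, ← integral_sub hint1 (integrable_finsetSum _ fun j _ => hint3 j)]
  have hvol : volume.real (cube d) = 2 ^ d := by
    rw [measureReal_def, volume_cube, ENNReal.toReal_ofReal (by positivity)]
  rw [← Real.norm_eq_abs, ← hvol]
  refine norm_setIntegral_le_of_norm_le_const (isCompact_cube d).measure_lt_top fun t ht => ?_
  have e2 : ∑ j : (∀ i, J i), (u t * ∏ i, l i (j i) (t i)) *
      ∏ i, Real.exp (-s i ^ 2 * (x i - y i (j i)) ^ 2) =
      u t * ∏ i, ∑ j, l i j (t i) * Real.exp (-s i ^ 2 * (x i - y i j) ^ 2) := by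
    rw [Fintype.prod_sum, mul_sum]
    refine sum_congr rfl fun j _ => ?_
    rw [mul_assoc, prod_mul_distrib]
  rw [e2, ← mul_sub, norm_mul]
  refine mul_le_mul (hS t ht) ?_ (norm_nonneg _) hS0
  have hd := fun i => H i (x i) (mem_cube_iff.1 hx i) (t i) (mem_cube_iff.1 ht i)
  have hone : ∀ i, |Real.exp (-σ i ^ 2 * (x i - t i) ^ 2)| ≤ 1 := fun i => by
    rw [abs_of_pos (Real.exp_pos _), Real.exp_le_one_iff]
    nlinarith [sq_nonneg (σ i * (x i - t i))]
  have := abs_prod_sub_prod_le (univ : Finset (Fin d))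
    (fun i => Real.exp (-σ i ^ 2 * (x i - t i) ^ 2))
    (fun i => ∑ j, l i j (t i) * Real.exp (-s i ^ 2 * (x i - y i j) ^ 2))
    (B := 1 + τ) (τ := τ) (by linarith) (fun i _ => (hone i).trans (by linarith))
    (fun i _ => by
      have h1 := hd i
      rw [abs_sub_comm] at h1
      have h2 := abs_sub_abs_le_abs_sub
        (∑ j, l i j (t i) * Real.exp (-s i ^ 2 * (x i - y i j) ^ 2))
        (Real.exp (-σ i ^ 2 * (x i - t i) ^ 2))
      linarith [hone i]) (fun i _ => hd i)
  rw [card_univ, Fintype.card_fin] at this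
  exact this

/-! ### Smoothing by normal densities -/

/-- The density of the normal distribution with mean `x` and variance `1 / (2 σ²)`. -/
noncomputable def normalDensity (σ x t : ℝ) : ℝ :=
  σ / Real.sqrt Real.pi * Real.exp (-σ ^ 2 * (x - t) ^ 2)

theorem integrable_normalDensity {σ : ℝ} (hσ : 0 < σ) (x : ℝ) :
    Integrable (normalDensity σ x) := by
  have := ((integrable_exp_neg_mul_sq (b := σ ^ 2) (by positivity)).comp_sub_left x).const_mul
    (σ / Real.sqrt Real.pi)
  exact this

theorem integral_normalDensity {σ : ℝ} (hσ : 0 < σ) (x : ℝ) :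
    ∫ t, normalDensity σ x t = 1 := by
  unfold normalDensity
  rw [integral_const_mul, integral_sub_left_eq_self (fun t => Real.exp (-σ ^ 2 * t ^ 2)) volume x,
    integral_gaussian, Real.sqrt_div Real.pi_pos.le, Real.sqrt_sq hσ.le]
  have := Real.sqrt_pos.2 Real.pi_pos
  field_simp

theorem abs_mul_normalDensity_le (σ x t : ℝ) :
    |x - t| * normalDensity σ x t ≤
      1 / Real.sqrt Real.pi * Real.exp (-(σ ^ 2 / 2) * (x - t) ^ 2) := by
  unfold normalDensity
  set z := x - t
  have h1 : σ * |z| ≤ Real.exp (σ ^ 2 / 2 * z ^ 2) := by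
    have := Real.add_one_le_exp (σ ^ 2 / 2 * z ^ 2)
    rw [← sq_abs z] at this ⊢
    nlinarith [sq_nonneg (σ * |z| - 1)]
  have e : -(σ ^ 2 / 2) * z ^ 2 = σ ^ 2 / 2 * z ^ 2 + -σ ^ 2 * z ^ 2 := by ring
  rw [e, Real.exp_add]
  calc _ = 1 / Real.sqrt Real.pi * ((σ * |z|) * Real.exp (-σ ^ 2 * z ^ 2)) := by ring
    _ ≤ _ := by gcongr

theorem integrable_abs_mul_normalDensity {σ : ℝ} (hσ : 0 < σ) (x : ℝ) :
    Integrable fun t => |x - t| * normalDensity σ x t := by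
  have := ((integrable_exp_neg_mul_sq (b := σ ^ 2 / 2) (by positivity)).comp_sub_left x).const_mul
    (1 / Real.sqrt Real.pi)
  refine this.mono' (by unfold normalDensity; fun_prop) (Filter.Eventually.of_forall fun t => ?_)
  rw [Real.norm_of_nonneg (by unfold normalDensity; positivity)]
  exact abs_mul_normalDensity_le σ x t

theorem integral_abs_mul_normalDensity_le {σ : ℝ} (hσ : 0 < σ) (x : ℝ) :
    ∫ t, |x - t| * normalDensity σ x t ≤ 2 / σ := by
  have h := ((integrable_exp_neg_mul_sq (b := σ ^ 2 / 2) (by positivity)).comp_sub_left x).const_mul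
    (1 / Real.sqrt Real.pi)
  refine (integral_mono (integrable_abs_mul_normalDensity hσ x) h
    fun t => abs_mul_normalDensity_le σ x t).trans ?_
  rw [integral_const_mul,
    integral_sub_left_eq_self (fun t => Real.exp (-(σ ^ 2 / 2) * t ^ 2)) volume x,
    integral_gaussian, div_div_eq_mul_div, Real.sqrt_div (by positivity), Real.sqrt_sq hσ.le,
    Real.sqrt_mul Real.pi_pos.le]
  have h2 : Real.sqrt 2 ≤ 2 := Real.sqrt_le_iff.2 (by norm_num)
  have := Real.sqrt_pos.2 Real.pi_pos
  calc _ = Real.sqrt 2 / σ := by field_simp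
    _ ≤ _ := by gcongr

/-- Smoothing changes `v` by at most the Lipschitz constants times the first absolute moments. -/
theorem abs_sub_integral_normalDensity_le {d : ℕ} {σ L : Fin d → ℝ} (hσ : ∀ i, 0 < σ i)
    (hL : ∀ i, 0 ≤ L i)
    {v : (Fin d → ℝ) → ℝ} (hc : Continuous v)
    (hv : ∀ x y, |v x - v y| ≤ ∑ i, L i * |x i - y i|) (x : Fin d → ℝ) :
    |v x - ∫ t, v t * ∏ i, normalDensity (σ i) (x i) (t i)| ≤ ∑ i, 2 / σ i * L i := by
  have hW : Integrable (fun t : Fin d → ℝ => ∏ i, normalDensity (σ i) (x i) (t i)) :=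
    Integrable.fintype_prod (μ := fun _ => volume) fun i => integrable_normalDensity (hσ i) (x i)
  have hW1 : ∫ t : Fin d → ℝ, ∏ i, normalDensity (σ i) (x i) (t i) = 1 := by
    rw [integral_fintype_prod_volume_eq_prod]
    exact prod_eq_one fun i _ => integral_normalDensity (hσ i) (x i)
  have hWnn : ∀ t : Fin d → ℝ, 0 ≤ ∏ i, normalDensity (σ i) (x i) (t i) := fun t =>
    prod_nonneg fun i _ => by have := (hσ i).le; unfold normalDensity; positivity
  -- the integrand of the first absolute moment in direction `i` is again a product of functions of one variable
  have eprod : ∀ i, ∀ t : Fin d → ℝ, |x i - t i| * ∏ j, normalDensity (σ j) (x j) (t j) =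
      ∏ j, (if j = i then |x j - t j| * normalDensity (σ j) (x j) (t j)
        else normalDensity (σ j) (x j) (t j)) := fun i t => by
    have : ∀ j, (if j = i then |x j - t j| * normalDensity (σ j) (x j) (t j)
        else normalDensity (σ j) (x j) (t j)) =
        (if j = i then |x j - t j| else 1) * normalDensity (σ j) (x j) (t j) := fun j => by
      split_ifs <;> simp
    simp_rw [this]
    rw [prod_mul_distrib, prod_ite_eq' univ i]
    simp
  have hi : ∀ i, Integrable (fun t : Fin d → ℝ =>
      |x i - t i| * ∏ j, normalDensity (σ j) (x j) (t j)) := fun i => by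
    simp_rw [eprod i]
    refine Integrable.fintype_prod (μ := fun _ => volume)
      (f := fun j t => if j = i then |x j - t| * normalDensity (σ j) (x j) t
        else normalDensity (σ j) (x j) t) fun j => ?_
    by_cases hj : j = i
    · simpa [hj] using integrable_abs_mul_normalDensity (hσ i) (x i)
    · simpa [hj] using integrable_normalDensity (hσ j) (x j)
  have hi2 : ∀ i, ∫ t : Fin d → ℝ, |x i - t i| * ∏ j, normalDensity (σ j) (x j) (t j) ≤
      2 / σ i := fun i => by
    simp_rw [eprod i]
    rw [integral_fintype_prod_volume_eq_prod
      (f := fun j t => if j = i then |x j - t| * normalDensity (σ j) (x j) t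
        else normalDensity (σ j) (x j) t), prod_eq_single i]
    · simpa using integral_abs_mul_normalDensity_le (hσ i) (x i)
    · intro j _ hj
      simpa [hj] using integral_normalDensity (hσ j) (x j)
    · simp
  have hbound : Integrable (fun t : Fin d → ℝ =>
      ∑ i, L i * (|x i - t i| * ∏ j, normalDensity (σ j) (x j) (t j))) :=
    integrable_finsetSum _ fun i _ => (hi i).const_mul _
  have hle : ∀ t : Fin d → ℝ, ‖(v x - v t) * ∏ j, normalDensity (σ j) (x j) (t j)‖ ≤
      ∑ i, L i * (|x i - t i| * ∏ j, normalDensity (σ j) (x j) (t j)) := fun t => by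
    rw [norm_mul, Real.norm_of_nonneg (hWnn t), Real.norm_eq_abs]
    calc _ ≤ (∑ i, L i * |x i - t i|) * ∏ j, normalDensity (σ j) (x j) (t j) :=
          mul_le_mul_of_nonneg_right (hv x t) (hWnn t)
      _ = _ := by rw [sum_mul]; simp_rw [mul_assoc]
  have hint : Integrable (fun t : Fin d → ℝ =>
      (v x - v t) * ∏ j, normalDensity (σ j) (x j) (t j)) :=
    hbound.mono' (by unfold normalDensity; fun_prop) (Filter.Eventually.of_forall hle)
  have e : v x - ∫ t, v t * ∏ i, normalDensity (σ i) (x i) (t i) =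
      ∫ t, (v x - v t) * ∏ i, normalDensity (σ i) (x i) (t i) := by
    have h1 : ∀ t : Fin d → ℝ, v t * ∏ i, normalDensity (σ i) (x i) (t i) =
        v x * (∏ i, normalDensity (σ i) (x i) (t i)) -
          (v x - v t) * ∏ i, normalDensity (σ i) (x i) (t i) := fun t => by ring
    simp_rw [h1]
    rw [integral_sub (hW.const_mul _) hint, integral_const_mul, hW1]
    ring
  rw [e, ← Real.norm_eq_abs]
  refine (norm_integral_le_of_norm_le hbound (Filter.Eventually.of_forall hle)).trans ?_
  rw [integral_finsetSum _ fun i _ => (hi i).const_mul _]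
  refine sum_le_sum fun i _ => ?_
  rw [integral_const_mul, mul_comm]
  exact mul_le_mul_of_nonneg_right (hi2 i) (hL i)

/-! ### Partial derivatives -/

/-- Changing the coordinates one at a time, bounds for the increments in each coordinate direction
add up. -/
theorem abs_sub_le_sum_of_update {d : ℕ} {I : Fin d → Set ℝ} {g : (Fin d → ℝ) → ℝ} {L : Fin d → ℝ}
    (h : ∀ z, (∀ j, z j ∈ I j) → ∀ i, ∀ t ∈ I i,
      |g (Function.update z i t) - g z| ≤ L i * |t - z i|)
    {x y : Fin d → ℝ} (hx : ∀ j, x j ∈ I j) (hy : ∀ j, y j ∈ I j) :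
    |g x - g y| ≤ ∑ i, L i * |x i - y i| := by
  have key : ∀ A : Finset (Fin d), |g (A.piecewise x y) - g y| ≤ ∑ i ∈ A, L i * |x i - y i| := by
    intro A
    induction A using Finset.induction_on with
    | empty => simp
    | insert i A hi ih =>
      rw [piecewise_insert, sum_insert hi]
      have hz : ∀ j, A.piecewise x y j ∈ I j := fun j => by
        by_cases hj : j ∈ A <;> simp [hj, hx j, hy j]
      have h1 := h _ hz i (x i) (hx i)
      rw [piecewise_eq_of_notMem _ _ _ hi] at h1
      refine (abs_sub_le _ (g (A.piecewise x y)) _).trans ?_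
      linarith
  simpa using key univ

/-- The function minus its linear part has partial derivatives at most `η` near `x`, and a small ball
for the supremum norm is a box. -/
theorem hasFDerivAt_of_continuousOn_partials {d : ℕ} {U : Set (Fin d → ℝ)} (hU : IsOpen U)
    {f : (Fin d → ℝ) → ℝ} {D : Fin d → (Fin d → ℝ) → ℝ} (hD : ∀ i, ContinuousOn (D i) U)
    (hf : ∀ x ∈ U, ∀ i, HasDerivAt (fun t => f (Function.update x i t)) (D i x) (x i))
    {x : Fin d → ℝ} (hx : x ∈ U) :
    HasFDerivAt f (∑ i, D i x • ContinuousLinearMap.proj (R := ℝ) (φ := fun _ : Fin d => ℝ) i) x := by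
  refine HasFDerivAt.of_isLittleO (Asymptotics.isLittleO_iff.2 fun c hc => ?_)
  set η := c / (d + 1) with hη
  have hη0 : 0 < η := by positivity
  have hev : ∀ᶠ z in nhds x, z ∈ U ∧ ∀ i, |D i z - D i x| ≤ η := by
    refine (hU.eventually_mem hx).and (Filter.eventually_all.2 fun i => ?_)
    have := ((hD i).continuousAt (hU.mem_nhds hx)).eventually (Metric.closedBall_mem_nhds _ hη0)
    filter_upwards [this] with z hz
    simpa [Real.dist_eq] using hz
  obtain ⟨r, hr, hball⟩ := Metric.eventually_nhds_iff_ball.1 hev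
  refine Metric.eventually_nhds_iff_ball.2 ⟨r, hr, fun y hy => ?_⟩
  have hbox : ∀ z : Fin d → ℝ, (∀ j, z j ∈ Metric.ball (x j) r) → z ∈ Metric.ball x r :=
    fun z hz => by
      rw [ball_pi _ hr]; exact fun j _ => hz j
  have key := abs_sub_le_sum_of_update (I := fun j => Metric.ball (x j) r)
    (g := fun z => f z - ∑ j, D j x * z j) (L := fun _ => η) (fun z hz i t ht => by
      have hup : ∀ s ∈ Metric.ball (x i) r, Function.update z i s ∈ Metric.ball x r := fun s hs =>
        hbox _ fun j => by
          by_cases hj : j = i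
          · subst hj; simpa using hs
          · simpa [hj] using hz j
      have hd : ∀ s ∈ Metric.ball (x i) r, HasDerivWithinAt
          (fun s => f (Function.update z i s) - D i x * s)
          (D i (Function.update z i s) - D i x) (Metric.ball (x i) r) s := fun s hs => by
        have h1 := hf _ (hball _ (hup s hs)).1 i
        simp only [Function.update_idem, Function.update_self] at h1
        have h2 := (hasDerivAt_id s).const_mul (D i x)
        simp only [id, mul_one] at h2
        exact (h1.sub h2).hasDerivWithinAt
      have h3 := (convex_ball (x i) r).norm_image_sub_le_of_norm_hasDerivWithin_le hd
        (fun s hs => (hball _ (hup s hs)).2 i) (hz i) ht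
      have h4 : ∑ j, D j x * Function.update z i t j - ∑ j, D j x * z j = D i x * (t - z i) := by
        rw [← sum_sub_distrib, sum_eq_single i]
        · simp; ring
        · intro j _ hj; simp [hj]
        · simp
      simp only [Function.update_eq_self, Real.norm_eq_abs] at h3
      refine le_trans (le_of_eq ?_) h3
      congr 1
      linear_combination -h4) (x := y) (y := x) (fun j => by
        rw [ball_pi _ hr] at hy; exact hy j trivial) (fun j => Metric.mem_ball_self hr)
  have e : f y - f x - (∑ i, D i x • ContinuousLinearMap.proj (R := ℝ) (φ := fun _ : Fin d => ℝ) i)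
      (y - x) = f y - ∑ j, D j x * y j - (f x - ∑ j, D j x * x j) := by
    simp [mul_sub, sum_sub_distrib]; ring
  rw [e, Real.norm_eq_abs]
  refine key.trans ?_
  calc ∑ i, η * |y i - x i| ≤ ∑ _i : Fin d, η * ‖y - x‖ := by
        gcongr with i
        exact norm_le_pi_norm (y - x) i
    _ = d * (η * ‖y - x‖) := by simp
    _ ≤ (d + 1) * (η * ‖y - x‖) := by
        gcongr; linarith
    _ = c * ‖y - x‖ := by rw [hη]; field_simp

theorem contDiffOn_one_of_continuousOn_partials {d : ℕ} {U : Set (Fin d → ℝ)} (hU : IsOpen U)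
    {f : (Fin d → ℝ) → ℝ} {D : Fin d → (Fin d → ℝ) → ℝ} (hD : ∀ i, ContinuousOn (D i) U)
    (hf : ∀ x ∈ U, ∀ i, HasDerivAt (fun t => f (Function.update x i t)) (D i x) (x i)) :
    ContDiffOn ℝ 1 f U := by
  have h := fun x (hx : x ∈ U) => hasFDerivAt_of_continuousOn_partials hU hD hf hx
  rw [show (1 : WithTop ℕ∞) = 0 + 1 by simp, contDiffOn_succ_iff_fderiv_of_isOpen hU]
  refine ⟨fun x hx => (h x hx).differentiableAt.differentiableWithinAt, by simp, ?_⟩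
  rw [contDiffOn_zero]
  refine ContinuousOn.congr (f := fun x =>
    ∑ i, D i x • ContinuousLinearMap.proj (R := ℝ) (φ := fun _ : Fin d => ℝ) i) ?_
    fun x hx => (h x hx).fderiv
  exact continuousOn_finsetSum _ fun i _ => (hD i).smul continuousOn_const

/-! ### Functions on the cube and their extension by zero -/

theorem mixedD_zero {d : ℕ} (f : (Fin d → ℝ) → ℝ) : mixedD 0 f = f := by
  have : ((List.finRange d).flatMap fun i => List.replicate ((0 : Fin d → ℕ) i) i) = [] :=
    List.flatMap_eq_nil_iff.2 fun i _ => rfl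
  rw [mixedD, this, List.foldr_nil]

theorem interior_cube (d : ℕ) : interior (cube d) = {x | ∀ i, x i ∈ Set.Ioo (-1 : ℝ) 1} := by
  rw [cube, ← Set.pi_univ_Icc, interior_pi_set Set.finite_univ]
  ext x
  simp

theorem mem_frontier_cube {d : ℕ} {x : Fin d → ℝ} (hx : x ∈ cube d) {i : Fin d}
    (hi : x i = -1 ∨ x i = 1) : x ∈ frontier (cube d) := by
  refine ⟨subset_closure hx, fun h => ?_⟩
  rw [interior_cube] at h
  have := h i
  rcases hi with hi | hi <;> simp [hi] at this

namespace MemF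

variable {d k : ℕ} {u : (Fin d → ℝ) → ℝ}

theorem continuousOn (hu : MemF k u) : ContinuousOn u (cube d) := by
  simpa [mixedD_zero] using (hu 0 (fun _ => Nat.zero_le _)).1

theorem hasDerivWithinAt_mixedD (hu : MemF k u) (hk : 1 ≤ k) (i : Fin d) {x : Fin d → ℝ}
    (hx : x ∈ cube d) :
    HasDerivWithinAt (fun t => u (Function.update x i t)) (mixedD (Pi.single i 1) u x)
      (Set.Icc (-1) 1) (x i) := by
  simpa [mixedD_zero] using (hu 0 (fun _ => Nat.zero_le _)).2 i hk x hx

theorem partialD_eq (hu : MemF k u) (hk : 1 ≤ k) (i : Fin d) {x : Fin d → ℝ} (hx : x ∈ cube d) :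
    partialD i u x = mixedD (Pi.single i 1) u x :=
  (hu.hasDerivWithinAt_mixedD hk i hx).derivWithin
    (uniqueDiffOn_Icc (by norm_num) _ (mem_cube_iff.1 hx i))

theorem hasDerivWithinAt_partialD (hu : MemF k u) (hk : 1 ≤ k) (i : Fin d) {x : Fin d → ℝ}
    (hx : x ∈ cube d) :
    HasDerivWithinAt (fun t => u (Function.update x i t)) (partialD i u x)
      (Set.Icc (-1) 1) (x i) := by
  rw [hu.partialD_eq hk i hx]; exact hu.hasDerivWithinAt_mixedD hk i hx

theorem continuousOn_partialD (hu : MemF k u) (hk : 1 ≤ k) (i : Fin d) :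
    ContinuousOn (partialD i u) (cube d) :=
  (hu (Pi.single i 1) (fun j => by
    by_cases hj : j = i
    · subst hj; simpa using hk
    · simp [hj])).1.congr fun _ hx => hu.partialD_eq hk i hx

end MemF

theorem abs_le_supNorm {d : ℕ} {f : (Fin d → ℝ) → ℝ} (hf : ContinuousOn f (cube d))
    {x : Fin d → ℝ} (hx : x ∈ cube d) : |f x| ≤ supNorm f := by
  obtain ⟨B, hB⟩ := (isCompact_cube d).exists_bound_of_continuousOn hf
  exact le_ciSup (f := fun x : cube d => |f x|) ⟨B, by rintro _ ⟨y, rfl⟩; exact hB y y.2⟩ ⟨x, hx⟩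

theorem supNorm_nonneg {d : ℕ} (f : (Fin d → ℝ) → ℝ) : 0 ≤ supNorm f :=
  Real.iSup_nonneg fun _ => abs_nonneg _

theorem supNorm_le_mixedNorm {d : ℕ} (k : ℕ) (f : (Fin d → ℝ) → ℝ) :
    supNorm f ≤ mixedNorm k f := by
  have := le_ciSup (f := fun α : Fin d → Fin (k + 1) => supNorm (mixedD (fun i => (α i : ℕ)) f))
    (Set.finite_range _).bddAbove (fun _ => 0)
  have h0 : mixedD (fun _ => ((0 : Fin (k + 1)) : ℕ)) f = f := mixedD_zero f
  rwa [h0] at this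

/-- Extension by zero of a function on `[-1, 1]` with zero boundary values keeps its Lipschitz
constant. -/
theorem abs_indicator_Icc_sub_le {φ : ℝ → ℝ} {L : ℝ} (hL : 0 ≤ L)
    (hφ : ∀ a ∈ Set.Icc (-1 : ℝ) 1, ∀ b ∈ Set.Icc (-1 : ℝ) 1, |φ a - φ b| ≤ L * |a - b|)
    (h₁ : φ (-1) = 0) (h₂ : φ 1 = 0) (a b : ℝ) :
    |(Set.Icc (-1 : ℝ) 1).indicator φ a - (Set.Icc (-1 : ℝ) 1).indicator φ b| ≤ L * |a - b| := by
  have h : (-1 : ℝ) ≤ 1 := by norm_num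
  have e : ∀ t, (Set.Icc (-1 : ℝ) 1).indicator φ t = φ (Set.projIcc (-1) 1 h t) := fun t => by
    by_cases ht : t ∈ Set.Icc (-1 : ℝ) 1
    · rw [Set.indicator_of_mem ht, Set.projIcc_of_mem h ht]
    · rw [Set.indicator_of_notMem ht]
      rcases lt_or_ge t (-1) with h3 | h3
      · rw [Set.projIcc_of_le_left h h3.le, h₁]
      · have h4 : 1 ≤ t := by
          by_contra h5
          exact ht ⟨h3, (not_le.1 h5).le⟩
        rw [Set.projIcc_of_right_le h h4, h₂]
  rw [e, e]
  refine (hφ _ (Set.projIcc (-1) 1 h a).2 _ (Set.projIcc (-1) 1 h b).2).trans ?_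
  exact mul_le_mul_of_nonneg_left (Set.abs_projIcc_sub_projIcc h) hL

theorem abs_indicator_cube_sub_le {d k : ℕ} (hk : 1 ≤ k) {u : (Fin d → ℝ) → ℝ} (hu : MemF k u)
    (h0 : ∀ x ∈ frontier (cube d), u x = 0) (x y : Fin d → ℝ) :
    |(cube d).indicator u x - (cube d).indicator u y| ≤
      ∑ i, supNorm (partialD i u) * |x i - y i| := by
  refine abs_sub_le_sum_of_update (I := fun _ => Set.univ) (fun z _ i t _ => ?_)
    (fun _ => trivial) (fun _ => trivial)
  have hL := supNorm_nonneg (partialD i u)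
  by_cases hz : ∀ j ≠ i, z j ∈ Set.Icc (-1 : ℝ) 1
  · have hmem : ∀ s, Function.update z i s ∈ cube d ↔ s ∈ Set.Icc (-1 : ℝ) 1 := fun s => by
      rw [mem_cube_iff]
      constructor
      · intro h; simpa using h i
      · intro h j
        by_cases hj : j = i
        · subst hj; simpa using h
        · simpa [hj] using hz j hj
    have hval : ∀ s, (cube d).indicator u (Function.update z i s) =
        (Set.Icc (-1 : ℝ) 1).indicator (fun s => u (Function.update z i s)) s := fun s => by
      by_cases hs : s ∈ Set.Icc (-1 : ℝ) 1
      · rw [Set.indicator_of_mem ((hmem s).2 hs), Set.indicator_of_mem hs]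
      · rw [Set.indicator_of_notMem fun h => hs ((hmem s).1 h), Set.indicator_of_notMem hs]
    have hlip : ∀ a ∈ Set.Icc (-1 : ℝ) 1, ∀ b ∈ Set.Icc (-1 : ℝ) 1,
        |u (Function.update z i a) - u (Function.update z i b)| ≤
          supNorm (partialD i u) * |a - b| := fun a ha b hb => by
      refine (convex_Icc (-1 : ℝ) 1).norm_image_sub_le_of_norm_hasDerivWithin_le
        (f := fun s => u (Function.update z i s))
        (f' := fun s => partialD i u (Function.update z i s)) (fun s hs => ?_) (fun s hs => ?_) hb ha
      · simpa using hu.hasDerivWithinAt_partialD hk i ((hmem s).2 hs)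
      · exact abs_le_supNorm (hu.continuousOn_partialD hk i) ((hmem s).2 hs)
    have key := abs_indicator_Icc_sub_le hL hlip
      (h0 _ (mem_frontier_cube ((hmem _).2 (by simp)) (i := i) (by simp)))
      (h0 _ (mem_frontier_cube ((hmem _).2 (by simp)) (i := i) (by simp))) t (z i)
    rw [← hval, ← hval, Function.update_eq_self] at key
    exact key
  · push Not at hz
    obtain ⟨j, hj, hzj⟩ := hz
    have h1 : Function.update z i t ∉ cube d := fun h => hzj (by
      simpa [hj] using mem_cube_iff.1 h j)
    have h2 : z ∉ cube d := fun h => hzj (mem_cube_iff.1 h j)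
    rw [Set.indicator_of_notMem h1, Set.indicator_of_notMem h2]
    simp only [sub_self, abs_zero]; positivity

theorem lipschitzWith_indicator_cube {d k : ℕ} (hk : 1 ≤ k) {u : (Fin d → ℝ) → ℝ} (hu : MemF k u)
    (h0 : ∀ x ∈ frontier (cube d), u x = 0) :
    LipschitzWith (∑ i, supNorm (partialD i u)).toNNReal ((cube d).indicator u) := by
  refine LipschitzWith.of_dist_le_mul fun x y => ?_
  rw [Real.coe_toNNReal _ (sum_nonneg fun i _ => supNorm_nonneg _), Real.dist_eq, sum_mul]
  refine (abs_indicator_cube_sub_le hk hu h0 x y).trans (sum_le_sum fun i _ => ?_)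
  exact mul_le_mul_of_nonneg_left (dist_le_pi_dist x y i) (supNorm_nonneg _)

theorem contDiffOn_indicator_cube {d k : ℕ} (hk : 1 ≤ k) {u : (Fin d → ℝ) → ℝ} (hu : MemF k u) :
    ContDiffOn ℝ 1 ((cube d).indicator u) (frontier (cube d))ᶜ := by
  have hint : ContDiffOn ℝ 1 u (interior (cube d)) :=
    contDiffOn_one_of_continuousOn_partials isOpen_interior
      (fun i => (hu.continuousOn_partialD hk i).mono interior_subset) fun x hx i =>
        (hu.hasDerivWithinAt_partialD hk i (interior_subset hx)).hasDerivAt (by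
          rw [interior_cube] at hx
          exact Icc_mem_nhds (hx i).1 (hx i).2)
  intro x hx
  refine ContDiffAt.contDiffWithinAt ?_
  by_cases hxc : x ∈ cube d
  · have hxi : x ∈ interior (cube d) := by
      by_contra h; exact hx ⟨subset_closure hxc, h⟩
    refine (hint.contDiffAt (isOpen_interior.mem_nhds hxi)).congr_of_eventuallyEq ?_
    filter_upwards [isOpen_interior.mem_nhds hxi] with z hz
    exact Set.indicator_of_mem (interior_subset hz) _
  · refine (contDiffAt_const (c := (0 : ℝ))).congr_of_eventuallyEq ?_
    filter_upwards [(isCompact_cube d).isClosed.isOpen_compl.mem_nhds hxc] with z hz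
    exact Set.indicator_of_notMem hz _

/-! ### Approximation by sums of `N` Gaussians -/

/-- A sum over at most `N` terms as a sum of exactly `N` terms, by adding zero coefficients. -/
theorem exists_fin_sum_eq {J E : Type*} [Fintype J] {N : ℕ} (hN : Fintype.card J ≤ N) (a : J → ℝ)
    (y : J → E) {P : E → Prop} {y₀ : E} (h₀ : P y₀) (hy : ∀ j, P (y j)) :
    ∃ (a' : Fin N → ℝ) (y' : Fin N → E), (∀ j, P (y' j)) ∧
      ∀ φ : E → ℝ, ∑ j, a' j * φ (y' j) = ∑ j, a j * φ (y j) := by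
  classical
  obtain ⟨f⟩ : Nonempty (J ↪ Fin N) :=
    Function.Embedding.nonempty_of_card_le (by simpa using hN)
  refine ⟨Function.extend f a 0, Function.extend f y fun _ => y₀, fun j => ?_, fun φ => ?_⟩
  · by_cases hj : ∃ i, f i = j
    · obtain ⟨i, rfl⟩ := hj
      rw [f.injective.extend_apply]; exact hy i
    · rw [Function.extend_apply' _ _ _ hj]; exact h₀
  · symm
    refine Fintype.sum_of_injective f f.injective _ _ (fun j hj => ?_) (fun i => ?_)
    · rw [Function.extend_apply' _ _ _ (by simpa using hj)]; simp
    · rw [f.injective.extend_apply, f.injective.extend_apply]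

theorem exists_nat_pow_le_and_le_two_mul_pow {d : ℕ} (hd : 1 ≤ d) {T : ℝ} (hT : 1 ≤ T) :
    ∃ n : ℕ, 1 ≤ n ∧ (n : ℝ) ^ d ≤ T ∧ T ≤ (2 * n : ℝ) ^ d := by
  set w := T ^ ((d : ℝ)⁻¹) with hw
  have hw1 : 1 ≤ w := Real.one_le_rpow hT (by positivity)
  have hwd : w ^ d = T := Real.rpow_inv_natCast_pow (by linarith) (by omega)
  have hn : 1 ≤ ⌊w⌋₊ := Nat.le_floor (by simpa using hw1)
  have hn' : (1 : ℝ) ≤ ⌊w⌋₊ := by exact_mod_cast hn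
  refine ⟨⌊w⌋₊, hn, ?_, ?_⟩ <;> rw [← hwd]
  · exact pow_le_pow_left₀ (by positivity) (Nat.floor_le (by linarith)) _
  · exact pow_le_pow_left₀ (by linarith) (by linarith [Nat.lt_floor_add_one w]) _

theorem integral_indicator_cube_mul_normalDensity {d : ℕ} (σ : Fin d → ℝ) (u : (Fin d → ℝ) → ℝ)
    (x : Fin d → ℝ) :
    ∫ t, (cube d).indicator u t * ∏ i, normalDensity (σ i) (x i) (t i) =
      (∏ i, σ i / Real.sqrt Real.pi) *
        ∫ t in cube d, u t * ∏ i, Real.exp (-σ i ^ 2 * (x i - t i) ^ 2) := by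
  rw [← integral_const_mul, ← integral_indicator (isCompact_cube d).measurableSet]
  congr 1
  ext t
  by_cases ht : t ∈ cube d
  · rw [Set.indicator_of_mem ht, Set.indicator_of_mem ht]
    unfold normalDensity
    rw [prod_mul_distrib]; ring
  · rw [Set.indicator_of_notMem ht, Set.indicator_of_notMem ht, zero_mul]

/-- Uniform approximation by sums of `N` Gaussians: a smoothing error, linear in the one-directional
Lipschitz constants `L i`, plus a discretization error. -/
theorem exists_gaussSum_approx {d : ℕ} (hd : 1 ≤ d) (k : ℕ) {Δ : ℝ} (hΔ : 1 ≤ Δ) :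
    ∃ K : ℝ, 0 < K ∧ ∀ (s L : Fin d → ℝ) (u : (Fin d → ℝ) → ℝ) (S : ℝ), (∀ i, 1 ≤ s i) →
      (∀ i, 0 ≤ L i) → ContinuousOn u (cube d) → (∀ x ∈ cube d, |u x| ≤ S) →
      Continuous ((cube d).indicator u) →
      (∀ x y, |(cube d).indicator u x - (cube d).indicator u y| ≤ ∑ i, L i * |x i - y i|) →
      ∀ N : ℕ, 1 ≤ N → ∃ (a : Fin N → ℝ) (y : Fin N → Fin d → ℝ), (∀ j, y j ∈ cube d) ∧
        ∀ x ∈ cube d, |u x - ∑ j, a j * ∏ i, Real.exp (-s i ^ 2 * (x i - y j i) ^ 2)| ≤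
          ∑ i, 2 / max (s i) Δ * L i + K * ((∏ i, s i) * (Real.sqrt N)⁻¹) ^ k * S := by
  obtain ⟨C, hC, H⟩ := exists_hasGaussExpansion Δ (d * (k + 1))
  set A : ℝ := 3 ^ d with hA
  set K₁ : ℝ := Δ ^ d * (d * (1 + C) ^ d * C * 2 ^ d) with hK₁
  have hΔ0 : 0 < Δ := by linarith
  refine ⟨A ^ k + K₁ * (2 ^ d * A) ^ (k + 1), by positivity, ?_⟩
  intro s L u S hs hL hu hS hvc hv N hN
  set E := ∏ i, s i with hE
  have hE1 : 1 ≤ E := by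
    simpa using prod_le_prod (s := univ) (f := fun _ : Fin d => (1 : ℝ)) (fun _ _ => zero_le_one)
      fun i _ => hs i
  have hN0 : (0 : ℝ) < N := by exact_mod_cast hN
  set r := (Real.sqrt N)⁻¹ with hr
  have hr0 : 0 < r := by positivity
  have hr2 : r ^ 2 = (N : ℝ)⁻¹ := by rw [hr, inv_pow, Real.sq_sqrt hN0.le]
  have h0mem : (0 : Fin d → ℝ) ∈ cube d := mem_cube_iff.2 fun i => by simp
  have hS0 : 0 ≤ S := (abs_nonneg _).trans (hS 0 h0mem)
  have hσ : ∀ i, 0 < max (s i) Δ := fun i => lt_max_of_lt_right hΔ0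
  have hsum0 : 0 ≤ ∑ i, 2 / max (s i) Δ * L i := sum_nonneg fun i _ =>
    mul_nonneg (div_nonneg zero_le_two (hσ i).le) (hL i)
  by_cases hcase : 1 ≤ A * (E * r)
  · -- few terms: the bound exceeds `S`, and the zero function serves
    refine ⟨0, fun _ => 0, fun _ => h0mem, fun x hx => ?_⟩
    simp only [Pi.zero_apply, zero_mul, sum_const_zero, sub_zero]
    refine (hS x hx).trans ?_
    have h1 : 1 ≤ A ^ k * (E * r) ^ k := by rw [← mul_pow]; exact one_le_pow₀ hcase
    calc S ≤ A ^ k * (E * r) ^ k * S := le_mul_of_one_le_left hS0 h1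
      _ ≤ (A ^ k + K₁ * (2 ^ d * A) ^ (k + 1)) * (E * r) ^ k * S := by
          gcongr
          exact le_add_of_nonneg_right (by positivity)
      _ ≤ _ := le_add_of_nonneg_left hsum0
  rw [not_le] at hcase
  have hA1 : 1 ≤ A := one_le_pow₀ (by norm_num)
  have hEr : E * r ≤ 1 := by nlinarith [mul_pos (lt_of_lt_of_le one_pos hE1) hr0]
  -- `T` bounds `n ^ d`, so that the number `3 ^ d * n ^ d * E` of terms is at most `N`
  set T := N / (A * E) with hT
  have hT1 : 1 ≤ T := by
    rw [hT, one_le_div (by positivity)]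
    have h1 : A * E * r ≤ 1 := by rw [mul_assoc]; exact hcase.le
    have h2 : A * E ≤ Real.sqrt N := by
      rwa [hr, ← div_eq_mul_inv, div_le_one (by positivity)] at h1
    have h3 : (1 : ℝ) ≤ N := by exact_mod_cast hN
    exact h2.trans (Real.sqrt_le_iff.2 ⟨hN0.le, by nlinarith⟩)
  obtain ⟨n, hn, hnT, hTn⟩ := exists_nat_pow_le_and_le_two_mul_pow hd hT1
  have hn0 : (0 : ℝ) < n := by exact_mod_cast hn
  have hn1 : (1 : ℝ) ≤ n := by exact_mod_cast hn
  set τ := C / (n : ℝ) ^ (d * (k + 1)) with hτ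
  have hτ0 : 0 ≤ τ := by positivity
  have hτC : τ ≤ C := div_le_self hC.le (one_le_pow₀ hn1)
  obtain ⟨J, _, y, a, hcard, hy, Ha⟩ := exists_gaussSum_approx_integral (s := s)
    (σ := fun i => max (s i) Δ) (M := fun i => 3 * n * s i) hτ0 (fun i => H (s i) (hs i) n hn) hu hS
  have hcardN : Fintype.card J ≤ N := by
    have : (Fintype.card J : ℝ) ≤ N := by
      refine hcard.trans ?_
      simp_rw [prod_mul_distrib, prod_const, card_univ, Fintype.card_fin]
      calc A * (n : ℝ) ^ d * E ≤ A * T * E := by gcongr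
        _ = N := by rw [hT]; field_simp
    exact_mod_cast this
  set ν := ∏ i, max (s i) Δ / Real.sqrt Real.pi with hν
  have hν0 : 0 ≤ ν := prod_nonneg fun i _ => div_nonneg (hσ i).le (Real.sqrt_nonneg _)
  have hνle : ν ≤ Δ ^ d * E := by
    have : Δ ^ d * E = ∏ i, Δ * s i := by simp [prod_mul_distrib, hE]
    rw [this]
    refine prod_le_prod (fun i _ => div_nonneg (hσ i).le (Real.sqrt_nonneg _)) fun i _ => ?_
    have hpi : 1 ≤ Real.sqrt Real.pi := Real.one_le_sqrt.2 (by linarith [Real.pi_gt_three])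
    refine (div_le_self (hσ i).le hpi).trans (max_le ?_ ?_)
    · exact le_mul_of_one_le_left (by linarith [hs i]) hΔ
    · exact le_mul_of_one_le_right hΔ0.le (hs i)
  obtain ⟨a', y', hy', Ha'⟩ := exists_fin_sum_eq hcardN (fun j => ν * a j) y
    (P := fun z => z ∈ cube d) h0mem hy
  refine ⟨a', y', hy', fun x hx => ?_⟩
  rw [Ha' fun z => ∏ i, Real.exp (-s i ^ 2 * (x i - z i) ^ 2)]
  have h1 := abs_sub_integral_normalDensity_le hσ hL hvc hv x
  rw [integral_indicator_cube_mul_normalDensity, Set.indicator_of_mem hx] at h1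
  have h2 := Ha x hx
  set I := ∫ t in cube d, u t * ∏ i, Real.exp (-max (s i) Δ ^ 2 * (x i - t i) ^ 2)
  refine (abs_sub_le _ (ν * I) _).trans (add_le_add h1 ?_)
  have e : ∑ j, ν * a j * ∏ i, Real.exp (-s i ^ 2 * (x i - y j i) ^ 2) =
      ν * ∑ j, a j * ∏ i, Real.exp (-s i ^ 2 * (x i - y j i) ^ 2) := by
    rw [mul_sum]; simp_rw [mul_assoc]
  rw [e, ← mul_sub, abs_mul, abs_of_nonneg hν0]
  have hnp : 1 / (n : ℝ) ^ (d * (k + 1)) ≤ (2 ^ d * A * (E * r ^ 2)) ^ (k + 1) := by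
    rw [pow_mul, ← one_div_pow]
    refine pow_le_pow_left₀ (by positivity) ?_ _
    have h3 : 2 ^ d * A * (E * r ^ 2) = 2 ^ d / T := by
      rw [hr2, hT]; field_simp
    rw [h3, div_le_div_iff₀ (by positivity) (by linarith), one_mul, ← mul_pow]
    exact hTn
  have hfin : E * (E * r ^ 2) ^ (k + 1) ≤ (E * r) ^ k := by
    have hr1 : r ≤ 1 := by nlinarith
    have e2 : E * (E * r ^ 2) ^ (k + 1) = (E * r) ^ k * ((E * r) ^ 2 * r ^ k) := by ring
    rw [e2]
    refine mul_le_of_le_one_right (by positivity) ?_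
    exact mul_le_one₀ (pow_le_one₀ (by positivity) hEr) (by positivity) (pow_le_one₀ hr0.le hr1)
  calc _ ≤ Δ ^ d * E * (S * (d * (1 + C) ^ d * τ) * 2 ^ d) := by
        refine mul_le_mul hνle (h2.trans ?_) (abs_nonneg _) (by positivity)
        gcongr
    _ = K₁ * S * (E * (1 / (n : ℝ) ^ (d * (k + 1)))) := by rw [hK₁, hτ]; ring
    _ ≤ K₁ * S * (E * (2 ^ d * A * (E * r ^ 2)) ^ (k + 1)) := by gcongr
    _ = K₁ * (2 ^ d * A) ^ (k + 1) * S * (E * (E * r ^ 2) ^ (k + 1)) := by rw [mul_pow]; ring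
    _ ≤ K₁ * (2 ^ d * A) ^ (k + 1) * S * (E * r) ^ k := by gcongr
    _ = K₁ * (2 ^ d * A) ^ (k + 1) * (E * r) ^ k * S := by ring
    _ ≤ (A ^ k + K₁ * (2 ^ d * A) ^ (k + 1)) * (E * r) ^ k * S := by
        gcongr
        exact le_add_of_nonneg_left (by positivity)

/-! ### Norms and constants of the error bound -/

theorem boxPhi_le_one {d : ℕ} (r : Fin d → ℝ) : boxPhi r ≤ 1 := by
  have hnn : ∀ t : ℝ, 0 ≤ 1 / Real.sqrt (2 * Real.pi) * Real.exp (-t ^ 2 / 2) := fun t => by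
    positivity
  have e : ∀ t : ℝ, -t ^ 2 / 2 = -(1 / 2) * t ^ 2 := fun t => by ring
  refine prod_le_one (fun i _ => integral_nonneg hnn) fun i _ => ?_
  have hint : Integrable fun t : ℝ => 1 / Real.sqrt (2 * Real.pi) * Real.exp (-t ^ 2 / 2) := by
    simp_rw [e]
    exact (integrable_exp_neg_mul_sq (by norm_num)).const_mul _
  refine (setIntegral_le_integral hint (Filter.Eventually.of_forall hnn)).trans (le_of_eq ?_)
  simp_rw [e]
  rw [integral_const_mul, integral_gaussian, div_div_eq_mul_div, div_one, mul_comm Real.pi]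
  have : 0 < Real.sqrt (2 * Real.pi) := by positivity
  field_simp

theorem gaussRBF_eq {d : ℕ} (s y x : Fin d → ℝ) :
    gaussRBF s y x = (∏ i, 1 / Real.sqrt (Real.pi * s i ^ (-2 : ℤ))) *
      ∏ i, Real.exp (-s i ^ 2 * (x i - y i) ^ 2) := prod_mul_distrib

theorem gaussRBF_self_le_mixedNorm (d k : ℕ) :
    (∏ _i : Fin d, 1 / Real.sqrt Real.pi) ≤
      mixedNorm k (gaussRBF (fun _ : Fin d => 1) (fun _ : Fin d => 0)) := by
  have hc : Continuous (gaussRBF (fun _ : Fin d => 1) (fun _ : Fin d => 0)) := by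
    unfold gaussRBF; fun_prop
  have h := abs_le_supNorm hc.continuousOn (x := 0) (mem_cube_iff.2 fun i => by simp)
  refine le_trans (le_of_eq ?_) ((le_abs_self _).trans (h.trans (supNorm_le_mixedNorm k _)))
  simp [gaussRBF]

theorem eLpNorm_two_cube_le {d : ℕ} {f : (Fin d → ℝ) → ℝ} {B : ℝ} (hf : ∀ x ∈ cube d, |f x| ≤ B) :
    eLpNorm f 2 (volume.restrict (cube d)) ≤ ENNReal.ofReal (Real.sqrt (2 ^ d) * B) := by
  have h := eLpNorm_le_of_ae_bound (p := 2) (μ := volume.restrict (cube d)) (f := f) (C := B)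
    ((ae_restrict_iff' (isCompact_cube d).measurableSet).2 (Filter.Eventually.of_forall hf))
  refine h.trans (le_of_eq ?_)
  rw [Measure.restrict_apply_univ, volume_cube, ENNReal.ofReal_rpow_of_pos (by positivity),
    ENNReal.ofReal_mul (by positivity), Real.sqrt_eq_rpow]
  norm_num

/-- The lower bound `4 * 2 ^ d` on the scales makes up for the measure `2 ^ d` of the cube. -/
theorem sqrt_two_pow_mul_le {d : ℕ} {ε : ℝ} (hε : 0 < ε) :
    Real.sqrt (2 ^ d) * (2 / max ε⁻¹ (4 * 2 ^ d)) ≤ ε ^ (1 / 2 : ℝ) := by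
  rw [← Real.sqrt_eq_rpow]
  set σ := max ε⁻¹ (4 * 2 ^ d) with hσ
  have h1 : ε⁻¹ ≤ σ := le_max_left _ _
  have h2 : (4 : ℝ) * 2 ^ d ≤ σ := le_max_right _ _
  have hσ0 : 0 < σ := lt_of_lt_of_le (by positivity) h1
  refine Real.le_sqrt_of_sq_le ?_
  rw [mul_pow, Real.sq_sqrt (by positivity), div_pow, mul_div_assoc', div_le_iff₀ (by positivity)]
  have h3 : 1 ≤ ε * σ := by
    rwa [inv_le_iff_one_le_mul₀ hε, mul_comm] at h1
  nlinarith

end GaussRBF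

theorem theorem1 (d k : ℕ) (hd : 1 ≤ d) (hk : 1 ≤ k) :
    ∃ c : ℝ, 0 < c ∧
      ∀ ε : Fin d → ℝ, (∀ i, 0 < ε i ∧ ε i < 1) →
      ∀ u : (Fin d → ℝ) → ℝ, GaussRBF.MemF k u →
        (∀ x ∈ frontier (GaussRBF.cube d), u x = 0) →
        (∃ v : (Fin d → ℝ) → ℝ,
          (∃ K, LipschitzWith K v) ∧
          ContDiffOn ℝ 1 v (frontier (GaussRBF.cube d))ᶜ ∧
          (∀ x ∉ GaussRBF.cube d, v x = 0) ∧
          (∀ x ∈ GaussRBF.cube d, v x = u x)) ∧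
        ∀ N : ℕ, 2 ≤ N →
          ∃ (a : Fin N → ℝ) (y : Fin N → Fin d → ℝ),
            (∀ j, y j ∈ GaussRBF.cube d) ∧
            MeasureTheory.eLpNorm
                (fun x => u x - ∑ j, a j * GaussRBF.gaussRBF (fun i => (ε i)⁻¹) (y j) x) 2
                (MeasureTheory.volume.restrict (GaussRBF.cube d)) ≤
              ENNReal.ofReal
                (((∑ i, (ε i) ^ (1 / 2 : ℝ) * GaussRBF.supNorm (GaussRBF.partialD i u)) +
                    2 * GaussRBF.supNorm u *
                      (1 - GaussRBF.boxPhi (fun i => (ε i) ^ (-(1 / 2) : ℝ)))) +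
                  (∏ i, (ε i) ^ (-(k : ℤ))) * 2 ^ (d + 2 * k) * c *
                    (N : ℝ) ^ (-(k : ℝ) / 2) * Real.log N ^ ((k + 2) * (d - 1) + 1) *
                    GaussRBF.mixedNorm k u *
                    GaussRBF.mixedNorm k
                      (GaussRBF.gaussRBF (fun _ : Fin d => 1) (fun _ : Fin d => 0))) := by
  obtain ⟨K, hK, H⟩ := GaussRBF.exists_gaussSum_approx hd k (Δ := 4 * 2 ^ d)
    (by nlinarith [one_le_pow₀ (M₀ := ℝ) (a := 2) (n := d) (by norm_num)])
  set β : ℝ := ∏ _i : Fin d, 1 / Real.sqrt Real.pi with hβ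
  have hβ0 : 0 < β := Finset.prod_pos fun _ _ => by positivity
  set b := (k + 2) * (d - 1) + 1 with hb
  have hlog2 : 0 < Real.log 2 := Real.log_pos (by norm_num)
  refine ⟨Real.sqrt (2 ^ d) * K / (Real.log 2 ^ b * β), by positivity, ?_⟩
  intro ε hε u hu h0
  have hlip := GaussRBF.lipschitzWith_indicator_cube hk hu h0
  refine ⟨⟨(GaussRBF.cube d).indicator u, ⟨_, hlip⟩, GaussRBF.contDiffOn_indicator_cube hk hu,
    fun x hx => Set.indicator_of_notMem hx _, fun x hx => Set.indicator_of_mem hx _⟩, ?_⟩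
  intro N hN
  set L : Fin d → ℝ := fun i => GaussRBF.supNorm (GaussRBF.partialD i u) with hL
  set S := GaussRBF.supNorm u with hS
  have hS0 : 0 ≤ S := GaussRBF.supNorm_nonneg u
  obtain ⟨a, y, hy, Ha⟩ := H (fun i => (ε i)⁻¹) L u S
    (fun i => (one_le_inv₀ (hε i).1).2 (hε i).2.le) (fun i => GaussRBF.supNorm_nonneg _)
    hu.continuousOn (fun x hx => GaussRBF.abs_le_supNorm hu.continuousOn hx) hlip.continuous
    (GaussRBF.abs_indicator_cube_sub_le hk hu h0) N (by omega)
  set ρ := ∏ i, 1 / Real.sqrt (Real.pi * (ε i)⁻¹ ^ (-2 : ℤ)) with hρ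
  have hρ0 : 0 < ρ := Finset.prod_pos fun i _ => by have := (hε i).1; positivity
  -- `ρ` is the normalization factor in `gaussRBF`
  refine ⟨fun j => a j / ρ, y, hy, ?_⟩
  have e : ∀ x, ∑ j, a j / ρ * GaussRBF.gaussRBF (fun i => (ε i)⁻¹) (y j) x =
      ∑ j, a j * ∏ i, Real.exp (-(ε i)⁻¹ ^ 2 * (x i - y j i) ^ 2) := fun x => by
    refine Finset.sum_congr rfl fun j _ => ?_
    rw [GaussRBF.gaussRBF_eq, ← mul_assoc, div_mul_cancel₀ _ hρ0.ne']
  simp_rw [e]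
  refine (GaussRBF.eLpNorm_two_cube_le Ha).trans (ENNReal.ofReal_le_ofReal ?_)
  rw [mul_add]
  -- the smoothing error goes into the first sum, the discretization error into the last term
  refine add_le_add ?_ ?_
  · refine le_add_of_le_of_nonneg ?_ (mul_nonneg (by positivity)
      (sub_nonneg.2 (GaussRBF.boxPhi_le_one _)))
    rw [Finset.mul_sum]
    refine Finset.sum_le_sum fun i _ => ?_
    rw [← mul_assoc]
    exact mul_le_mul_of_nonneg_right (GaussRBF.sqrt_two_pow_mul_le (hε i).1)
      (GaussRBF.supNorm_nonneg _)
  · have hN0 : (0 : ℝ) < N := by exact_mod_cast (by omega : 0 < N)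
    have eN : (N : ℝ) ^ (-(k : ℝ) / 2) = (Real.sqrt N)⁻¹ ^ k := by
      rw [Real.sqrt_eq_rpow, ← Real.rpow_neg hN0.le, ← Real.rpow_natCast, ← Real.rpow_mul hN0.le]
      congr 1; ring
    have eE : ∏ i, (ε i) ^ (-(k : ℤ)) = (∏ i, (ε i)⁻¹) ^ k := by
      rw [← Finset.prod_pow]
      exact Finset.prod_congr rfl fun i _ => by rw [zpow_neg, zpow_natCast, inv_pow]
    have hE0 : 0 < ∏ i, (ε i)⁻¹ := Finset.prod_pos fun i _ => inv_pos.2 (hε i).1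
    have hlogN : Real.log 2 ^ b ≤ Real.log N ^ b :=
      pow_le_pow_left₀ hlog2.le (Real.log_le_log two_pos (by exact_mod_cast hN)) _
    have hMu : S ≤ GaussRBF.mixedNorm k u := GaussRBF.supNorm_le_mixedNorm k u
    have hMB := GaussRBF.gaussRBF_self_le_mixedNorm d k
    rw [eN, eE]
    set E := ∏ i, (ε i)⁻¹
    set r := (Real.sqrt N)⁻¹ with hr
    have hr0 : 0 ≤ r := by positivity
    set V := Real.sqrt (2 ^ d)
    have hMu0 : 0 ≤ GaussRBF.mixedNorm k u := hS0.trans hMu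
    have hlogN0 : 0 ≤ Real.log N := Real.log_natCast_nonneg N
    have hpow : (1 : ℝ) ≤ 2 ^ (d + 2 * k) := one_le_pow₀ (by norm_num)
    calc V * (K * (E * r) ^ k * S) =
        E ^ k * 1 * (V * K / (Real.log 2 ^ b * β)) * r ^ k * Real.log 2 ^ b * S * β := by
          rw [mul_pow]; field_simp
      _ ≤ _ := by
          gcongr
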